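/- **Setting.** Let $S=\langle d_1,\dots,d_m\rangle\subset\mathbb N$ be a numerical semigroup with minimal generators $d_1,\dots,d_m$ ($\gcd(d_1,\dots,d_m)=1$). Let $S$ be symmetric (for its Frobenius number $F$ and every integer $n$, exactly one of $n$, $F-n$ lies in $S$) and not a complete intersection (over a field $\mathbb K$, the defining ideal of $\mathbb K[t^{d_1},\dots,t^{d_m}]$ in $\mathbb K[x_1,\dots,x_m]$ is not generated by $m-1$ elements). Let $G_r=\sum_{s\in\mathbb N\setminus S}s^r$ $(r\ge 0)$ be the genera of $S$, and for $0\le k\le m-1$ let $\beta_k$ be the Betti numbers of $\mathbb K[t^{d_1},\dots,t^{d_m}]$ over $\mathbb K[x_1,\dots,x_m]$ and $C_{k,1},\dots,C_{k,\beta_k}$ the degrees of the $k$-th syzygies. Put $$\zeta_{2q}=\sum_{j=0}^{q-1}\beta_j\quad(m=2q),\qquad \zeta_{2q+1}=\sum_{j=0}^{q-1}\beta_j+\tfrac12\beta_q\quad(m=2q+1).$$ Regard the syzygy degrees as unknowns: let $V$ be the set of all families $(C_{k,j})$, $0\le k\le m-1$, $1\le j\le\beta_k$, of complex numbers, together with complex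 numbers $Q$ and $G_0,G_1,G_2,\dots$, such that * $C_{0,1}=0$ and $C_{k,j}+C_{m-1-k,\,\beta_k+1-j}=Q$ for all $k,j$ (recall that $\beta_0=1$ and $\beta_k=\beta_{m-1-k}$); * all polynomial identities between the alternating power sums of the $C_{k,j}$ and the genera hold, i.e. as formal power series in $t$, with $z=e^t$, $$(1-z)\sum_{k=0}^{m-1}(-1)^k\sum_{j=1}^{\beta_k}z^{C_{k,j}}=\prod_{i=1}^m\bigl(1-z^{d_i}\bigr)\Bigl(1-(1-z)\sum_{r\ge0}G_r\frac{t^r}{r!}\Bigr).$$ Each $G_r$ is a function on $V$. **Theorem.** The syzygy degrees of $S$ (in a suitable order in each row) together with the genera of $S$ form a point of $V$. The number of algebraically independent genera is $$g_{2q}=\zeta_{2q}-q\quad\text{if }m=2q,\qquad g_{2q+1}=\zeta_{2q+1}-q\quad\text{if }m=2q+1.$$ Precisely, with $g=g_m$: the $g$ functions $G_0,G_1,G_3,\dots,G_{2g-3}$ on $V$ are algebraically independent over $\mathbb C$; every $G_n$, $n\ge0$, is algebraic over the algebra $\mathbb C[G_0,G_1,G_3,\dots,G_{2g-3}]$ of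 functions on $V$; and no family of more than $g$ of the functions $G_r$ is algebraically independent. Moreover the genera of even index depend on those of smaller index through the symmetry relations: on $V$, with $F=2G_0-1$ and the Bernoulli numbers $\mathcal B_k$, for all $r\ge1$, $$G_{2r}=F\left(\frac12\sum_{p=0}^{2r-2}\left[\binom{2r}{p}\frac{\mathcal B_{2r-p}}{p+1}+(-1)^p\binom{2r}{p+1}G_{2r-p-1}\right]F^p-\frac{2r-1}{2r+1}\cdot\frac{F^{2r}}4\right),$$ so that, recursively, each $G_{2r}$ is a polynomial in $G_0,G_1,G_3,\dots,G_{2r-1}$. -/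

import Mathlib

open Finset PowerSeries

noncomputable section

/-- The additive submonoid of `ℕ` generated by `d 0, …, d (m - 1)`. -/
def semigroupOf {m : ℕ} (d : Fin m → ℕ) : AddSubmonoid ℕ :=
  AddSubmonoid.closure (Set.range d)

/-- `d` lists the minimal generators of a numerical semigroup: the greatest common divisor is `1`
and no generator lies in the semigroup generated by the other ones (so the generators are positive
and pairwise distinct, and `m` is the embedding dimension). -/
structure IsMinimalGeneratingTuple {m : ℕ} (d : Fin m → ℕ) : Prop where
  gcd_eq_one : Finset.univ.gcd d = 1
  minimal : ∀ i, d i ∉ AddSubmonoid.closure (d '' {j | j ≠ i})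

/-- Membership of an integer in the semigroup. -/
def IntMem {m : ℕ} (d : Fin m → ℕ) (n : ℤ) : Prop :=
  ∃ s ∈ semigroupOf d, (s : ℤ) = n

/-- The semigroup is symmetric: for some integer `F` (necessarily the Frobenius number),
exactly one of `n`, `F - n` belongs to it, for every integer `n`. -/
def IsSymmetricSemigroup {m : ℕ} (d : Fin m → ℕ) : Prop :=
  ∃ F : ℤ, ∀ n : ℤ, IntMem d n ↔ ¬ IntMem d (F - n)

/-- The defining ideal of the semigroup ring `𝕂[t^{d 0}, …, t^{d (m-1)}]`. -/
def definingIdeal (𝕂 : Type*) [Field 𝕂] {m : ℕ} (d : Fin m → ℕ) :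
    Ideal (MvPolynomial (Fin m) 𝕂) :=
  RingHom.ker (MvPolynomial.aeval (R := 𝕂) fun i => (Polynomial.X : Polynomial 𝕂) ^ d i)

/-- Complete intersection: the defining ideal, of height `m - 1`, is generated by `m - 1`
polynomials. -/
def IsCompleteIntersectionSemigroup (𝕂 : Type*) [Field 𝕂] {m : ℕ} (d : Fin m → ℕ) : Prop :=
  ∃ s : Finset (MvPolynomial (Fin m) 𝕂),
    s.card + 1 = m ∧ Ideal.span (s : Set (MvPolynomial (Fin m) 𝕂)) = definingIdeal 𝕂 d

/-- The genus of order `r`: the sum of the `r`-th powers of the gaps. -/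
def genus {m : ℕ} (d : Fin m → ℕ) (r : ℕ) : ℕ :=
  ∑ᶠ s ∈ {s : ℕ | s ∉ semigroupOf d}, s ^ r

/-! ### Graded Betti numbers

The syzygies of the semigroup ring `R = 𝕂[t^{d 0}, …, t^{d (m-1)}]` over
`𝕂[x 0, …, x (m-1)]`, with `x i` in degree `d i` acting as `t^{d i}`, are counted by
`Tor k (R, 𝕂)`, which is the homology of the Koszul complex `R ⊗ ⋀ 𝕂^m` of
`t^{d 0}, …, t^{d (m-1)}`. In degree `s` and homological degree `k` this complex has the basis
`t ^ (s - ∑ i ∈ A, d i) ⊗ e_A`, where `A` has `k` elements and `s - ∑ i ∈ A, d i` lies in the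
semigroup. -/

/-- The degree `s` part of the `k`-th term of the Koszul complex: coefficient functions supported on
the basis elements. -/
def koszulChains (𝕂 : Type*) [Field 𝕂] {m : ℕ} (d : Fin m → ℕ) (k s : ℕ) :
    Submodule 𝕂 (Finset (Fin m) → 𝕂) where
  carrier := {c | ∀ A, c A ≠ 0 → A.card = k ∧ ∃ t ∈ semigroupOf d, t + ∑ i ∈ A, d i = s}
  zero_mem' := fun A h => absurd rfl h
  add_mem' := by
    intro a b ha hb A h
    by_cases h0 : a A = 0
    · exact hb A (by intro h1; exact h (by simp [h0, h1]))
    · exact ha A h0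
  smul_mem' := by
    intro r a ha A h
    exact ha A (by intro h1; exact h (by simp [h1]))

/-- The Koszul differential
`t^u ⊗ e_A ↦ ∑ i ∈ A, (-1)^{#{j ∈ A, j < i}} t^{u + d i} ⊗ e_{A \ {i}}` in coordinates. -/
def koszulDifferential (𝕂 : Type*) [Field 𝕂] (m : ℕ) :
    (Finset (Fin m) → 𝕂) →ₗ[𝕂] (Finset (Fin m) → 𝕂) where
  toFun c A := ∑ i ∈ Finset.univ \ A, (-1) ^ (A.filter (· < i)).card * c (insert i A)
  map_add' := by
    intro a b
    funext A
    simp [mul_add, Finset.sum_add_distrib]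
  map_smul' := by
    intro r a
    funext A
    simp only [Pi.smul_apply, smul_eq_mul, RingHom.id_apply, Finset.mul_sum, mul_left_comm]

/-- Koszul cycles of degree `s` in homological degree `k`. -/
def koszulCycles (𝕂 : Type*) [Field 𝕂] {m : ℕ} (d : Fin m → ℕ) (k s : ℕ) :
    Submodule 𝕂 (Finset (Fin m) → 𝕂) :=
  koszulChains 𝕂 d k s ⊓ LinearMap.ker (koszulDifferential 𝕂 m)

/-- Koszul boundaries of degree `s` in homological degree `k`. -/
def koszulBoundaries (𝕂 : Type*) [Field 𝕂] {m : ℕ} (d : Fin m → ℕ) (k s : ℕ) :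
    Submodule 𝕂 (Finset (Fin m) → 𝕂) :=
  (koszulChains 𝕂 d (k + 1) s).map (koszulDifferential 𝕂 m)

/-- The graded Betti number: the number of `k`-th syzygies of degree `s`. -/
def gradedBetti (𝕂 : Type*) [Field 𝕂] {m : ℕ} (d : Fin m → ℕ) (k s : ℕ) : ℕ :=
  Module.finrank 𝕂
    (koszulCycles 𝕂 d k s ⧸ (koszulBoundaries 𝕂 d k s).submoduleOf (koszulCycles 𝕂 d k s))

/-- The (partial) Betti number `β k`: the number of all `k`-th syzygies. -/
def betti (𝕂 : Type*) [Field 𝕂] {m : ℕ} (d : Fin m → ℕ) (k : ℕ) : ℕ :=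
  ∑ᶠ s, gradedBetti 𝕂 d k s

/-- The number of independent variables among the degrees of syzygies of a symmetric semigroup.
If `m = 2 q` it is `β 0 + ⋯ + β (q - 1)`. If `m = 2 q + 1` it is
`β 0 + ⋯ + β (q - 1) + β q / 2`, since the degrees in the middle row are paired among themselves. -/
def variableCount (𝕂 : Type*) [Field 𝕂] {m : ℕ} (d : Fin m → ℕ) : ℕ :=
  if Even m then ∑ k ∈ Finset.range (m / 2), betti 𝕂 d k
  else (∑ k ∈ Finset.range (m / 2), betti 𝕂 d k) + betti 𝕂 d (m / 2) / 2

/-- The power series `exp (a t)`, that is `z ^ a` for `z = exp t`. -/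
def expSeries (a : ℂ) : ℂ⟦X⟧ := PowerSeries.rescale a (PowerSeries.exp ℂ)

/-- A point of the solution variety of the polynomial identities for the degrees of syzygies and the
genera of a symmetric semigroup with generators `d` and Betti numbers `b`. The degrees
`C k j` (`0 ≤ k < m`, `j < b k`) are unknowns that satisfy
* `C 0 j = 0`;
* the symmetry: the rows `k` and `m - 1 - k` are exchanged by `x ↦ Q - x` (listed in reverse);
* all the polynomial identities which relate the alternating power sums
  `∑ k, (-1)^k ∑ j, (C k j)^n`, `n = 0, 1, 2, …`, to the genera `G r`. They are the coefficients
  at `t^n` of the identity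
  `∑ k, (-1)^k ∑ j, z^(C k j) = ∏ i, (1 - z^(d i)) * (1 / (1 - z) - Φ(z))` for `z = exp t`,
  where `Φ(exp t) = ∑ r, G r * t^r / r!` (as `Φ(z) = ∑ z^s` over the gaps `s`). -/
@[ext]
structure SyzygySolution {m : ℕ} (d : Fin m → ℕ) (b : ℕ → ℕ) where
  /-- the degrees of syzygies -/
  C : (k : Fin m) → Fin (b k) → ℂ
  /-- the largest degree -/
  Q : ℂ
  /-- the genera -/
  G : ℕ → ℂ
  zero_row : ∀ (k : Fin m) (j : Fin (b k)), (k : ℕ) = 0 → C k j = 0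
  symm : ∀ (k l : Fin m) (j : Fin (b k)) (j' : Fin (b l)),
    (k : ℕ) + l + 1 = m → (j : ℕ) + j' + 1 = b k → C k j + C l j' = Q
  hilbert :
    (1 - expSeries 1) * ∑ k : Fin m, (-1) ^ (k : ℕ) * ∑ j : Fin (b k), expSeries (C k j) =
      (∏ i, (1 - expSeries (d i))) *
        (1 - (1 - expSeries 1) * PowerSeries.mk fun r => G r / (r.factorial : ℂ))

/-- The genus of order `r` as a function on the solution variety. -/
def genusFunction {m : ℕ} (d : Fin m → ℕ) (b : ℕ → ℕ) (r : ℕ) : SyzygySolution d b → ℂ :=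
  fun w => w.G r

/-- The index of the `i`-th genus in the list `G 0, G 1, G 3, G 5, …`. -/
def genusIndex (i : ℕ) : ℕ := if i = 0 then 0 else 2 * i - 1

end

/-! Point of V. In degree `s` the Koszul complex is spanned by the sets `A` with `s - ∑_A d` in the
semigroup, inside the acyclic complex of all subsets. For a symmetric semigroup, with `s + s' = F +
∑ d`, a set `A` occurs in degree `s` exactly when its complement does not occur in degree `s'`.
Alexander duality therefore identifies row `k` of the Betti table with the reversed row `m - 1 - k`
(`gradedBetti_le_of_dual`), and the Euler characteristic of the complex gives the Hilbert identity.

Equations of V. Centre the degrees: `y = C - Q/2`, so that the symmetry becomes `y ↦ -y`. The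
Hilbert identity says that `∑ ± exp(y t)` equals `t^(m-1) U exp(-Q t/2) (1 - t V Φ)`, with `U`, `V`
universal and `Φ` the generating series of the genera. Hence the signed power sums of order below `m
- 1` vanish, the one of order `m - 1` is a nonzero constant, and each later one is a polynomial in
`Q` and the genera of smaller index. By symmetry only exponents of the parity of `m - 1` matter, and
half of the nodes suffice. With `q = m / 2` this leaves `ζ` nodes subject to `q` equations.
Conversely, every solution of these equations comes from a point of V, with `Q` and the genera
recovered from the nodes.

Upper bound. In a field, such equations force at least `q` distinct nonzero squares of nodes
carrying nonzero total weight. A Vandermonde argument on Kähler differentials makes `q` nodes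
algebraic over the others, so the transcendence degree is at most `ζ - q`
(`exists_subset_closure_of_sum_pow`). Functions on V need not form a domain, so an independent
family is first carried into the fraction field of a quotient by a prime
(`exists_algHom_field_algebraicIndependent`).

Lower bound. Near the point given by the semigroup, the inverse function theorem lets `ζ - q` nodes
vary freely. After specialization to a field that keeps them independent, the equality case of the
upper bound makes all squares of nodes distinct and nonzero. Replacing `t` by `-t` in the Hilbert
identity expresses the even genera through smaller ones. Hence `G 0, G 1, G 3, …, G (2 g - 3)`
determine `Q`, hence the node `-Q/2`, and enough power sums to make the other `ζ - 1` nodes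
algebraic over them. These `g` genera thus have transcendence degree at least `g`, so they are
independent. -/

noncomputable section

/-! ### The Koszul complex in one degree: acyclicity of the full complex, pairing of complementary
faces -/

section Koszul

variable {𝕂 : Type*} [Field 𝕂] {m : ℕ} {d : Fin m → ℕ}

theorem koszulDifferential_apply (c : Finset (Fin m) → 𝕂) (A : Finset (Fin m)) :
    koszulDifferential 𝕂 m c A =
      ∑ i ∈ Finset.univ \ A, (-1) ^ (A.filter (· < i)).card * c (insert i A) :=
  rfl

theorem card_filter_lt_insert {A : Finset (Fin m)} {i : Fin m} (hi : i ∉ A) (j : Fin m) :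
    ((insert i A).filter (· < j)).card = (A.filter (· < j)).card + if i < j then 1 else 0 := by
  rw [Finset.filter_insert]
  split_ifs with h
  · rw [Finset.card_insert_of_notMem (by simp [hi])]
  · rfl

/-- The two orders of removing `i` and `j` cancel: the smaller index is counted in the sign of the
larger one in exactly one of them. -/
theorem koszulDifferential_comp_self (c : Finset (Fin m) → 𝕂) :
    koszulDifferential 𝕂 m (koszulDifferential 𝕂 m c) = 0 := by
  funext A
  simp only [koszulDifferential_apply, Finset.mul_sum, Pi.zero_apply]
  rw [Finset.sum_sigma']
  refine Finset.sum_involution (fun p _ => ⟨p.2, p.1⟩) ?_ ?_ ?_ ?_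
  · rintro ⟨i, j⟩ h
    simp only [Finset.mem_sigma, Finset.mem_sdiff, Finset.mem_univ, true_and,
      Finset.mem_insert, not_or] at h
    obtain ⟨hi, hji, hj⟩ := h
    dsimp only
    rw [card_filter_lt_insert hi, card_filter_lt_insert hj, Finset.insert_comm j i]
    rcases lt_or_gt_of_ne hji with h | h
    · simp only [h, if_true, if_neg h.not_gt]
      ring
    · simp only [h, if_true, if_neg h.not_gt]
      ring
  · rintro ⟨i, j⟩ h _ e
    simp only [Finset.mem_sigma, Finset.mem_sdiff, Finset.mem_univ, true_and,
      Finset.mem_insert, not_or] at h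
    simp only [Sigma.mk.injEq, heq_eq_eq] at e
    exact h.2.1 e.1
  · rintro ⟨i, j⟩ h
    simp only [Finset.mem_sigma, Finset.mem_sdiff, Finset.mem_univ, true_and,
      Finset.mem_insert, not_or] at h ⊢
    exact ⟨h.2.2, fun e => h.2.1 e.symm, h.1⟩
  · rintro ⟨i, j⟩ h
    rfl

theorem koszulDifferential_mem_koszulChains {k s : ℕ} {c : Finset (Fin m) → 𝕂}
    (hc : c ∈ koszulChains 𝕂 d (k + 1) s) :
    koszulDifferential 𝕂 m c ∈ koszulChains 𝕂 d k s := by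
  intro A hA
  rw [koszulDifferential_apply] at hA
  obtain ⟨i, hi, h⟩ := Finset.exists_ne_zero_of_sum_ne_zero hA
  have hiA : i ∉ A := by simpa using hi
  obtain ⟨h1, t, ht, h2⟩ := hc _ (right_ne_zero_of_mul h)
  rw [Finset.card_insert_of_notMem hiA] at h1
  rw [Finset.sum_insert hiA] at h2
  refine ⟨by omega, t + d i, add_mem ht (AddSubmonoid.subset_closure ⟨i, rfl⟩), by omega⟩

theorem koszulBoundaries_le_koszulCycles (k s : ℕ) :
    koszulBoundaries 𝕂 d k s ≤ koszulCycles 𝕂 d k s := by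
  rintro _ ⟨c, hc, rfl⟩
  exact ⟨koszulDifferential_mem_koszulChains hc, koszulDifferential_comp_self c⟩

theorem gradedBetti_add_finrank_koszulBoundaries (k s : ℕ) :
    gradedBetti 𝕂 d k s + Module.finrank 𝕂 (koszulBoundaries 𝕂 d k s) =
      Module.finrank 𝕂 (koszulCycles 𝕂 d k s) := by
  rw [gradedBetti, ← Submodule.finrank_quotient_add_finrank
    ((koszulBoundaries 𝕂 d k s).submoduleOf (koszulCycles 𝕂 d k s))]
  congr 1
  exact (Submodule.submoduleOfEquivOfLe (koszulBoundaries_le_koszulCycles k s)).finrank_eq.symm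

theorem finrank_koszulCycles_add (k s : ℕ) :
    Module.finrank 𝕂 ((koszulChains 𝕂 d k s).map (koszulDifferential 𝕂 m)) +
      Module.finrank 𝕂 (koszulCycles 𝕂 d k s) = Module.finrank 𝕂 (koszulChains 𝕂 d k s) := by
  have h := LinearMap.finrank_range_add_finrank_ker
    ((koszulDifferential 𝕂 m).domRestrict (koszulChains 𝕂 d k s))
  rw [LinearMap.range_domRestrict, LinearMap.ker_domRestrict] at h
  rw [← h, koszulCycles, ← Submodule.map_comap_subtype]
  congr 1
  exact (Submodule.equivMapOfInjective _ (Submodule.subtype_injective _) _).finrank_eq.symm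

/-- The contracting homotopy of the full exterior complex that multiplies by `e_0`. -/
def koszulHomotopy (𝕂 : Type*) [Field 𝕂] (n : ℕ) :
    (Finset (Fin (n + 1)) → 𝕂) →ₗ[𝕂] (Finset (Fin (n + 1)) → 𝕂) where
  toFun c A := if 0 ∈ A then c (A.erase 0) else 0
  map_add' a b := by
    funext A
    by_cases h : (0 : Fin (n + 1)) ∈ A <;> simp [h]
  map_smul' r a := by
    funext A
    by_cases h : (0 : Fin (n + 1)) ∈ A <;> simp [h]

theorem koszulHomotopy_apply {n : ℕ} (c : Finset (Fin (n + 1)) → 𝕂) (A : Finset (Fin (n + 1))) :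
    koszulHomotopy 𝕂 n c A = if 0 ∈ A then c (A.erase 0) else 0 := rfl

/-- The complex of all subsets is a cone with apex `0`. Nothing precedes `0`, so its own sign is
trivial, while its presence flips the sign of every other index and the cross terms cancel. -/
theorem koszulDifferential_koszulHomotopy {n : ℕ} (c : Finset (Fin (n + 1)) → 𝕂) :
    koszulDifferential 𝕂 (n + 1) (koszulHomotopy 𝕂 n c) +
      koszulHomotopy 𝕂 n (koszulDifferential 𝕂 (n + 1) c) = c := by
  funext A
  simp only [Pi.add_apply, koszulHomotopy_apply, koszulDifferential_apply]
  by_cases h0 : (0 : Fin (n + 1)) ∈ A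
  · have e : (Finset.univ \ A.erase 0 : Finset (Fin (n + 1))) = insert 0 (Finset.univ \ A) := by
      ext x
      simp only [Finset.mem_sdiff, Finset.mem_univ, true_and, Finset.mem_erase, Finset.mem_insert,
        not_and]
      tauto
    rw [if_pos h0, e, Finset.sum_insert (by simp [h0])]
    have e0 : ((A.erase 0).filter (· < (0 : Fin (n + 1)))).card = 0 := by
      simp
    rw [e0, Finset.insert_erase h0, pow_zero, one_mul, add_left_comm, ← Finset.sum_add_distrib,
      Finset.sum_eq_zero, add_zero]
    intro i hi
    have hiA : i ∉ A := by simpa using hi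
    have hi0 : i ≠ 0 := fun h => hiA (h ▸ h0)
    have h1 : (A.filter (· < i)).card = ((A.erase 0).filter (· < i)).card + 1 := by
      conv_lhs => rw [← Finset.insert_erase h0]
      rw [card_filter_lt_insert (Finset.notMem_erase _ _), if_pos (Fin.pos_of_ne_zero hi0)]
    rw [if_pos (Finset.mem_insert_of_mem h0), h1, Finset.erase_insert_of_ne hi0]
    ring
  · rw [if_neg h0, add_zero, Finset.sum_eq_single_of_mem 0 (by simp [h0])]
    · simp [h0]
    · intro i _ hi
      rw [if_neg, mul_zero]
      simp [h0, hi.symm]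

theorem koszulDifferential_koszulHomotopy_of_mem_ker {n : ℕ} {c : Finset (Fin (n + 1)) → 𝕂}
    (hc : koszulDifferential 𝕂 (n + 1) c = 0) :
    koszulDifferential 𝕂 (n + 1) (koszulHomotopy 𝕂 n c) = c := by
  simpa [hc] using koszulDifferential_koszulHomotopy c

theorem card_of_koszulHomotopy_ne_zero {n k s : ℕ} {d : Fin (n + 1) → ℕ}
    {c : Finset (Fin (n + 1)) → 𝕂} (hc : c ∈ koszulChains 𝕂 d k s) {A : Finset (Fin (n + 1))}
    (h : koszulHomotopy 𝕂 n c A ≠ 0) : A.card = k + 1 := by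
  rw [koszulHomotopy_apply] at h
  split_ifs at h with h0
  · rw [← (hc _ h).1, Finset.card_erase_of_mem h0]
    have := Finset.card_pos.2 ⟨_, h0⟩
    omega
  · exact absurd rfl h

/-- In a degree where every face occurs, the Koszul complex is exact. -/
theorem gradedBetti_eq_zero_of_forall {n k s : ℕ} {d : Fin (n + 1) → ℕ}
    (h : ∀ A : Finset (Fin (n + 1)), A.card = k + 1 →
      ∃ t ∈ semigroupOf d, t + ∑ i ∈ A, d i = s) :
    gradedBetti 𝕂 d k s = 0 := by
  have h1 : koszulCycles 𝕂 d k s ≤ koszulBoundaries 𝕂 d k s := by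
    rintro c ⟨hc, hc0⟩
    refine ⟨koszulHomotopy 𝕂 n c, fun A hA => ?_,
      koszulDifferential_koszulHomotopy_of_mem_ker hc0⟩
    have := card_of_koszulHomotopy_ne_zero hc hA
    exact ⟨this, h A this⟩
  have h2 := gradedBetti_add_finrank_koszulBoundaries (𝕂 := 𝕂) (d := d) k s
  rw [le_antisymm h1 (koszulBoundaries_le_koszulCycles k s)] at h2
  omega

theorem gradedBetti_eq_zero_of_le {n k s : ℕ} {d : Fin (n + 1) → ℕ} (hk : n + 1 ≤ k) :
    gradedBetti 𝕂 d k s = 0 := by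
  refine gradedBetti_eq_zero_of_forall fun A hA => ?_
  have := A.card_le_univ
  rw [Fintype.card_fin] at this
  omega

/-- The perfect pairing between complementary faces for which the differential is self-adjoint. -/
def koszulPairing (𝕂 : Type*) [Field 𝕂] (m : ℕ) :
    (Finset (Fin m) → 𝕂) →ₗ[𝕂] (Finset (Fin m) → 𝕂) →ₗ[𝕂] 𝕂 :=
  LinearMap.mk₂ 𝕂 (fun b c => ∑ A : Finset (Fin m), (-1) ^ (∑ i ∈ A, (i : ℕ)) * b A * c Aᶜ)
    (by intros; simp [mul_add, add_mul, Finset.sum_add_distrib])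
    (by intros; simp only [Pi.smul_apply, smul_eq_mul, Finset.mul_sum]
        exact Finset.sum_congr rfl fun _ _ => by ring)
    (by intros; simp [mul_add, Finset.sum_add_distrib])
    (by intros; simp only [Pi.smul_apply, smul_eq_mul, Finset.mul_sum]
        exact Finset.sum_congr rfl fun _ _ => by ring)

theorem koszulPairing_apply (b c : Finset (Fin m) → 𝕂) :
    koszulPairing 𝕂 m b c = ∑ A : Finset (Fin m), (-1) ^ (∑ i ∈ A, (i : ℕ)) * b A * c Aᶜ := rfl

theorem card_filter_lt_add_card_filter_compl (A : Finset (Fin m)) (i : Fin m) :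
    (A.filter (· < i)).card + (Aᶜ.filter (· < i)).card = i := by
  rw [← Finset.card_union_of_disjoint, ← Finset.filter_union, Finset.union_compl]
  · have : (Finset.univ.filter (· < i)) = Finset.Iio i := by ext; simp
    rw [this, Fin.card_Iio]
  · exact Finset.disjoint_filter_filter disjoint_compl_right

/-- Passing from `A` to `insert i A` changes the sign of the pairing by `(-1)^i`, and `i` is the
number of smaller indices in `A` plus the number in its complement; these are the two signs of the
differential. -/
theorem koszulPairing_koszulDifferential (b c : Finset (Fin m) → 𝕂) :
    koszulPairing 𝕂 m (koszulDifferential 𝕂 m b) c =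
      koszulPairing 𝕂 m b (koszulDifferential 𝕂 m c) := by
  simp only [koszulPairing_apply, koszulDifferential_apply, Finset.mul_sum, Finset.sum_mul]
  rw [Finset.sum_sigma', Finset.sum_sigma']
  refine Finset.sum_bij' (fun p _ => ⟨insert p.2 p.1, p.2⟩) (fun p _ => ⟨p.1.erase p.2, p.2⟩)
    ?_ ?_ ?_ ?_ ?_
  · rintro ⟨A, i⟩ h
    simp
  · rintro ⟨A, i⟩ h
    simp
  · rintro ⟨A, i⟩ h
    have : i ∉ A := by simpa using h
    simp [this]
  · rintro ⟨A, i⟩ h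
    have : i ∈ A := by simpa using h
    simp [this]
  · rintro ⟨A, i⟩ h
    have hi : i ∉ A := by simpa using h
    dsimp only
    have h1 : insert i (insert i A)ᶜ = Aᶜ := by
      ext x
      by_cases hx : x = i <;> simp [hx, hi]
    have h2 : ((insert i A)ᶜ.filter (· < i)) = (Aᶜ.filter (· < i)) := by
      ext x
      simp only [Finset.mem_filter, Finset.mem_compl, Finset.mem_insert, not_or]
      constructor
      · rintro ⟨⟨_, a⟩, b⟩; exact ⟨a, b⟩
      · rintro ⟨a, b⟩; exact ⟨⟨b.ne, a⟩, b⟩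
    rw [h1, h2, Finset.sum_insert hi, ← card_filter_lt_add_card_filter_compl A i]
    have h3 : ((-1 : 𝕂) ^ (Aᶜ.filter (· < i)).card) * (-1) ^ (Aᶜ.filter (· < i)).card = 1 := by
      rw [← mul_pow]; simp
    rw [pow_add, pow_add]
    linear_combination (-(b (insert i A) * c Aᶜ * (-1) ^ (∑ i ∈ A, (i : ℕ)) *
      (-1) ^ (A.filter (· < i)).card)) * h3

theorem koszulPairing_single (b : Finset (Fin m) → 𝕂) (A : Finset (Fin m)) :
    koszulPairing 𝕂 m b (Pi.single Aᶜ 1) = (-1) ^ (∑ i ∈ A, (i : ℕ)) * b A := by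
  rw [koszulPairing_apply, Finset.sum_eq_single A]
  · simp
  · intro B _ hB
    rw [Pi.single_eq_of_ne, mul_zero]
    simpa using hB
  · simp

/-- Every functional is represented by the pairing. -/
theorem exists_koszulPairing_eq (φ : (Finset (Fin m) → 𝕂) →ₗ[𝕂] 𝕂) :
    ∃ v, koszulPairing 𝕂 m v = φ := by
  refine ⟨fun A => (-1) ^ (∑ i ∈ A, (i : ℕ)) * φ (Pi.single Aᶜ 1), ?_⟩
  refine LinearMap.pi_ext' fun A => LinearMap.ext_ring ?_
  obtain ⟨B, rfl⟩ : ∃ B, A = Bᶜ := ⟨Aᶜ, by simp⟩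
  simp only [LinearMap.comp_apply, LinearMap.single_apply, koszulPairing_single]
  rw [← mul_assoc, ← mul_pow]
  simp

end Koszul

end

noncomputable section

/-! ### Alexander duality, Euler characteristic and row zero of the Betti table -/

section KoszulDuality

variable {𝕂 : Type*} [Field 𝕂] {m : ℕ} {d : Fin m → ℕ}

/-- A cycle that bounds a chain whose pairing with all the cycles of the dual complex vanishes
is a boundary. -/
theorem mem_koszulBoundaries_of_koszulPairing_eq_zero {n k l s s' : ℕ} {d : Fin (n + 1) → ℕ}
    (hkl : k + l = n)
    (hdual : ∀ A : Finset (Fin (n + 1)), (∃ t ∈ semigroupOf d, t + ∑ i ∈ A, d i = s) ↔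
      ¬ ∃ t ∈ semigroupOf d, t + ∑ i ∈ Aᶜ, d i = s')
    {c : Finset (Fin (n + 1)) → 𝕂} (hc : c ∈ koszulCycles 𝕂 d k s)
    (h : ∀ e ∈ koszulCycles 𝕂 d l s',
      koszulPairing 𝕂 (n + 1) (koszulHomotopy 𝕂 n c) e = 0) :
    c ∈ koszulBoundaries 𝕂 d k s := by
  classical
  obtain ⟨hc1, hc2⟩ := hc
  have hb : koszulDifferential 𝕂 (n + 1) (koszulHomotopy 𝕂 n c) = c :=
    koszulDifferential_koszulHomotopy_of_mem_ker hc2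
  set b := koszulHomotopy 𝕂 n c with hbdef
  have h1 : (koszulPairing 𝕂 (n + 1) b).comp (koszulChains 𝕂 d l s').subtype ∈
      (LinearMap.ker ((koszulDifferential 𝕂 (n + 1)).domRestrict
        (koszulChains 𝕂 d l s'))).dualAnnihilator := by
    rw [Submodule.mem_dualAnnihilator]
    intro e he
    exact h e.1 ⟨e.2, he⟩
  -- Pairing with `b` kills the cycles of the dual complex, so it factors through the differential.
  -- The resulting functional is pairing with some `v`, and self-adjointness replaces it by pairing
  -- with the boundary of `v`.
  rw [← LinearMap.range_dualMap_eq_dualAnnihilator_ker] at h1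
  obtain ⟨φ, hφ⟩ := h1
  obtain ⟨v, rfl⟩ := exists_koszulPairing_eq φ
  have h2 : ∀ e ∈ koszulChains 𝕂 d l s', koszulPairing 𝕂 (n + 1) b e =
      koszulPairing 𝕂 (n + 1) (koszulDifferential 𝕂 (n + 1) v) e := by
    intro e he
    rw [koszulPairing_koszulDifferential]
    exact (LinearMap.congr_fun hφ ⟨e, he⟩).symm
  -- Outside the degree `s` complex the complementary face lies in the dual one. Testing on it shows
  -- that `b` agrees there with the boundary of `v`, so `b` minus that boundary is a genuine chain
  -- that still bounds `c`.
  have h3 : ∀ A : Finset (Fin (n + 1)), A.card = k + 1 →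
      (¬ ∃ t ∈ semigroupOf d, t + ∑ i ∈ A, d i = s) →
      b A = koszulDifferential 𝕂 (n + 1) v A := by
    intro A hA hAs
    rw [hdual, not_not] at hAs
    have he : (Pi.single Aᶜ 1 : Finset (Fin (n + 1)) → 𝕂) ∈ koszulChains 𝕂 d l s' := by
      intro B hB
      obtain rfl : B = Aᶜ := by
        by_contra hne
        exact hB (Pi.single_eq_of_ne hne _)
      refine ⟨?_, hAs⟩
      rw [Finset.card_compl, Fintype.card_fin]
      omega
    have := h2 _ he
    rw [koszulPairing_single, koszulPairing_single] at this
    exact mul_left_cancel₀ (pow_ne_zero _ (neg_ne_zero.2 one_ne_zero)) this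
  -- `v` may have components in every homological degree, hence the truncation.
  refine ⟨fun A => if A.card = k + 1 then b A - koszulDifferential 𝕂 (n + 1) v A else 0, ?_, ?_⟩
  · intro A hA
    simp only [ne_eq, ite_eq_right_iff, Classical.not_imp] at hA
    refine ⟨hA.1, ?_⟩
    by_contra hne
    exact hA.2 (sub_eq_zero.2 (h3 A hA.1 hne))
  · have h4 : koszulDifferential 𝕂 (n + 1) (b - koszulDifferential 𝕂 (n + 1) v) = c := by
      rw [map_sub, koszulDifferential_comp_self, sub_zero, hb]
    funext A
    by_cases hA : A.card = k
    · rw [← h4, koszulDifferential_apply, koszulDifferential_apply]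
      refine Finset.sum_congr rfl fun i hi => ?_
      rw [if_pos]
      · rfl
      · rw [Finset.card_insert_of_notMem (by simpa using hi), hA]
    · have hcA : c A = 0 := by
        by_contra hne
        exact hA (hc1 A hne).1
      rw [hcA, koszulDifferential_apply]
      refine Finset.sum_eq_zero fun i hi => ?_
      rw [if_neg, mul_zero]
      rw [Finset.card_insert_of_notMem (by simpa using hi)]
      omega

/-- One half of Gorenstein duality for graded Betti numbers. -/
theorem gradedBetti_le_of_dual {n k l s s' : ℕ} {d : Fin (n + 1) → ℕ} (hkl : k + l = n)
    (hdual : ∀ A : Finset (Fin (n + 1)), (∃ t ∈ semigroupOf d, t + ∑ i ∈ A, d i = s) ↔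
      ¬ ∃ t ∈ semigroupOf d, t + ∑ i ∈ Aᶜ, d i = s') :
    gradedBetti 𝕂 d k s ≤ gradedBetti 𝕂 d l s' := by
  let Z := koszulCycles 𝕂 d k s
  let Z' := koszulCycles 𝕂 d l s'
  let B' := (koszulBoundaries 𝕂 d l s').submoduleOf Z'
  -- A linking form: fill `c` in the full complex and pair the filling with a dual cycle. The kernel
  -- consists of boundaries and the form kills dual boundaries, so homology in degree `s` embeds in
  -- the dual of homology in degree `s'`.
  let Φ : Z →ₗ[𝕂] Module.Dual 𝕂 Z' :=
    Z'.subtype.dualMap ∘ₗ koszulPairing 𝕂 (n + 1) ∘ₗ koszulHomotopy 𝕂 n ∘ₗ Z.subtype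
  have hker : LinearMap.ker Φ ≤ (koszulBoundaries 𝕂 d k s).submoduleOf Z := by
    intro c hc
    refine mem_koszulBoundaries_of_koszulPairing_eq_zero hkl hdual c.2 fun e he => ?_
    exact LinearMap.congr_fun (LinearMap.mem_ker.1 hc) ⟨e, he⟩
  have hrange : LinearMap.range Φ ≤ B'.dualAnnihilator := by
    rintro _ ⟨c, rfl⟩
    rw [Submodule.mem_dualAnnihilator]
    rintro ⟨e, he'⟩ he
    obtain ⟨u, hu, rfl⟩ : e ∈ koszulBoundaries 𝕂 d l s' := he
    change koszulPairing 𝕂 (n + 1) (koszulHomotopy 𝕂 n c.1) (koszulDifferential 𝕂 (n + 1) u) = 0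
    -- The differential moves to the filling and returns `c`; then `c` and `u` are never nonzero on
    -- complementary faces.
    rw [← koszulPairing_koszulDifferential,
      koszulDifferential_koszulHomotopy_of_mem_ker c.2.2, koszulPairing_apply]
    refine Finset.sum_eq_zero fun A _ => ?_
    by_contra hne
    exact (hdual A).1 ((c.2.1 A (right_ne_zero_of_mul (left_ne_zero_of_mul hne))).2)
      ((hu Aᶜ (right_ne_zero_of_mul hne)).2)
  have h1 := LinearMap.finrank_range_add_finrank_ker Φ
  have h2 := Submodule.finrank_mono hker
  have h3 := Submodule.finrank_mono hrange
  have h4 := Subspace.finrank_add_finrank_dualAnnihilator_eq B'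
  have h5 := Submodule.finrank_quotient_add_finrank B'
  have h6 := Submodule.finrank_quotient_add_finrank ((koszulBoundaries 𝕂 d k s).submoduleOf Z)
  change Module.finrank 𝕂 (Z ⧸ (koszulBoundaries 𝕂 d k s).submoduleOf Z) ≤
    Module.finrank 𝕂 (Z' ⧸ B')
  omega

theorem finrank_koszulChains (k s : ℕ) :
    Module.finrank 𝕂 (koszulChains 𝕂 d k s) =
      Nat.card {A : Finset (Fin m) // A.card = k ∧ ∃ t ∈ semigroupOf d, t + ∑ i ∈ A, d i = s} := by
  classical
  let p : Finset (Fin m) → Prop := fun A =>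
    A.card = k ∧ ∃ t ∈ semigroupOf d, t + ∑ i ∈ A, d i = s
  let e : koszulChains 𝕂 d k s ≃ₗ[𝕂] ({A // p A} → 𝕂) :=
    { toFun := fun c A => c.1 A.1
      map_add' := fun _ _ => rfl
      map_smul' := fun _ _ => rfl
      invFun := fun f => ⟨fun A => if h : p A then f ⟨A, h⟩ else 0, fun A hA => by
        by_contra hp
        exact hA (dif_neg hp)⟩
      left_inv := fun c => by
        ext A
        by_cases h : p A
        · simp [h]
        · have : c.1 A = 0 := by
            by_contra hne
            exact h (c.2 A hne)
          simp [h, this]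
      right_inv := fun f => by
        ext A
        simp [A.2] }
  rw [e.finrank_eq, Module.finrank_fintype_fun_eq_card, Nat.card_eq_fintype_card]

theorem koszulCycles_zero (s : ℕ) : koszulCycles 𝕂 d 0 s = koszulChains 𝕂 d 0 s := by
  refine inf_eq_left.2 fun x hx => LinearMap.mem_ker.2 (funext fun A => ?_)
  rw [koszulDifferential_apply]
  refine Finset.sum_eq_zero fun i _ => ?_
  by_contra hne
  have := (hx _ (right_ne_zero_of_mul hne)).1
  rw [Finset.card_eq_zero] at this
  exact Finset.insert_ne_empty _ _ this

open Classical in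
/-- The Euler characteristic of the Koszul complex in a fixed degree. -/
theorem sum_neg_one_pow_mul_gradedBetti {n : ℕ} {d : Fin (n + 1) → ℕ} (s : ℕ) :
    ∑ k : Fin (n + 1), (-1 : ℤ) ^ (k : ℕ) * gradedBetti 𝕂 d k s =
      ∑ A : Finset (Fin (n + 1)),
        if ∃ t ∈ semigroupOf d, t + ∑ i ∈ A, d i = s then (-1) ^ A.card else 0 := by
  let B : ℕ → ℤ := fun k => Module.finrank 𝕂 (koszulBoundaries 𝕂 d k s)
  let c : ℕ → ℤ := fun k => Module.finrank 𝕂 (koszulChains 𝕂 d k s)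
  have h0 : (gradedBetti 𝕂 d 0 s : ℤ) = c 0 - B 0 := by
    have h1 := gradedBetti_add_finrank_koszulBoundaries (𝕂 := 𝕂) (d := d) 0 s
    rw [koszulCycles_zero] at h1
    simp only [c, B]
    omega
  have hk : ∀ k, (gradedBetti 𝕂 d (k + 1) s : ℤ) = c (k + 1) - B k - B (k + 1) := by
    intro k
    have h1 := gradedBetti_add_finrank_koszulBoundaries (𝕂 := 𝕂) (d := d) (k + 1) s
    have h2 := finrank_koszulCycles_add (𝕂 := 𝕂) (d := d) (k + 1) s
    change Module.finrank 𝕂 (koszulBoundaries 𝕂 d k s) + _ = _ at h2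
    simp only [c, B]
    omega
  have hsum : ∀ N : ℕ, ∑ k ∈ range (N + 1), (-1 : ℤ) ^ k * gradedBetti 𝕂 d k s =
      ∑ k ∈ range (N + 1), (-1 : ℤ) ^ k * c k - (-1) ^ N * B N := by
    intro N
    induction N with
    | zero => simp [h0]
    | succ N ih =>
      rw [Finset.sum_range_succ, ih, Finset.sum_range_succ _ (N + 1), hk]
      ring
  have hB : B (n + 1) = 0 := by
    simp only [B, Nat.cast_eq_zero]
    have : koszulBoundaries 𝕂 d (n + 1) s = ⊥ := by
      rw [eq_bot_iff]
      rintro _ ⟨x, hx, rfl⟩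
      rw [Submodule.mem_bot]
      suffices h : x = 0 by rw [h, map_zero]
      funext A
      by_contra hne
      have h1 := (hx A hne).1
      have := A.card_le_univ
      rw [Fintype.card_fin] at this
      omega
    rw [this, finrank_bot]
  -- The top Koszul homology vanishes, so the alternating sum may stop at `n`.
  have hlast : gradedBetti 𝕂 d (n + 1) s = 0 := gradedBetti_eq_zero_of_le le_rfl
  have h1 := hsum (n + 1)
  rw [hB, mul_zero, sub_zero, Finset.sum_range_succ, hlast, Nat.cast_zero, mul_zero, add_zero]
    at h1
  rw [Fin.sum_univ_eq_sum_range (fun k => (-1 : ℤ) ^ k * (gradedBetti 𝕂 d k s : ℤ)), h1]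
  rw [← Finset.sum_fiberwise_of_maps_to (s := Finset.univ) (t := range (n + 1 + 1))
    (g := fun A : Finset (Fin (n + 1)) => A.card)]
  · refine Finset.sum_congr rfl fun k _ => ?_
    rw [← Finset.sum_filter, Finset.filter_filter]
    simp only [c]
    rw [finrank_koszulChains, Nat.card_eq_fintype_card, Fintype.card_subtype,
      Finset.sum_congr rfl (g := fun _ => (-1 : ℤ) ^ k), Finset.sum_const, nsmul_eq_mul, mul_comm]
    intro A hA
    rw [(Finset.mem_filter.1 hA).2.1]
  · intro A _
    have := A.card_le_univ
    rw [Fintype.card_fin] at this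
    rw [Finset.mem_range]
    omega

theorem gradedBetti_zero_zero (hd : ∀ i, 0 < d i) : gradedBetti 𝕂 d 0 0 = 1 := by
  have h1 := gradedBetti_add_finrank_koszulBoundaries (𝕂 := 𝕂) (d := d) 0 0
  have h2 : koszulBoundaries 𝕂 d 0 0 = ⊥ := by
    rw [eq_bot_iff]
    rintro _ ⟨x, hx, rfl⟩
    rw [Submodule.mem_bot]
    suffices h : x = 0 by rw [h, map_zero]
    funext A
    by_contra hne
    obtain ⟨hA, t, -, ht⟩ := hx A hne
    obtain ⟨i, rfl⟩ := Finset.card_eq_one.1 hA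
    rw [Finset.sum_singleton] at ht
    have := hd i
    omega
  rw [h2, finrank_bot, add_zero, koszulCycles_zero, finrank_koszulChains] at h1
  rw [h1, Nat.card_eq_one_iff_unique]
  refine ⟨⟨fun a b => Subtype.ext ?_⟩, ⟨⟨∅, by simp, 0, zero_mem _, by simp⟩⟩⟩
  rw [Finset.card_eq_zero.1 a.2.1, Finset.card_eq_zero.1 b.2.1]

theorem exists_add_eq_of_mem_semigroupOf {s : ℕ} (hs : s ∈ semigroupOf d) (h0 : s ≠ 0) :
    ∃ i, ∃ t ∈ semigroupOf d, t + d i = s := by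
  induction hs using AddSubmonoid.closure_induction with
  | mem x hx =>
    obtain ⟨i, rfl⟩ := hx
    exact ⟨i, 0, zero_mem _, zero_add _⟩
  | zero => exact absurd rfl h0
  | add x y hx hy ihx ihy =>
    by_cases hx0 : x = 0
    · subst hx0
      rw [zero_add] at h0 ⊢
      exact ihy h0
    · obtain ⟨i, t, ht, rfl⟩ := ihx hx0
      exact ⟨i, t + y, add_mem ht hy, by ring⟩

/-- A nonzero element of the semigroup is `u + d i`, and then the basis element of degree `s` is the
boundary of `t^u ⊗ e_i`. -/
theorem gradedBetti_zero_of_ne_zero {s : ℕ} (hs : s ≠ 0) : gradedBetti 𝕂 d 0 s = 0 := by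
  have h1 := gradedBetti_add_finrank_koszulBoundaries (𝕂 := 𝕂) (d := d) 0 s
  have h2 : koszulBoundaries 𝕂 d 0 s = koszulCycles 𝕂 d 0 s := by
    refine le_antisymm (koszulBoundaries_le_koszulCycles 0 s) ?_
    rw [koszulCycles_zero]
    intro c hc
    by_cases hc0 : c ∅ = 0
    · suffices h : c = 0 by rw [h]; exact zero_mem _
      funext A
      by_contra hne
      rw [Finset.card_eq_zero.1 (hc A hne).1] at hne
      exact hne hc0
    obtain ⟨-, t, ht, hts⟩ := hc ∅ hc0
    rw [Finset.sum_empty, add_zero] at hts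
    subst hts
    obtain ⟨i, u, hu, hui⟩ := exists_add_eq_of_mem_semigroupOf ht hs
    have hsupp : ∀ A : Finset (Fin m),
        (Pi.single {i} (c ∅) : Finset (Fin m) → 𝕂) A ≠ 0 → A = {i} := by
      intro A hA
      by_contra hne
      exact hA (Pi.single_eq_of_ne hne _)
    refine ⟨Pi.single {i} (c ∅), fun A hA => ?_, ?_⟩
    · rw [hsupp A hA]
      exact ⟨Finset.card_singleton i, u, hu, by rw [Finset.sum_singleton, hui]⟩
    · funext A
      rw [koszulDifferential_apply]
      by_cases hA : A = ∅
      · subst hA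
        rw [Finset.sum_eq_single i]
        · simp
        · intro j _ hj
          rw [insert_empty_eq, Pi.single_eq_of_ne, mul_zero]
          simpa using hj
        · simp
      · have h0 : c A = 0 := by
          by_contra hne
          exact hA (Finset.card_eq_zero.1 (hc A hne).1)
        rw [h0]
        refine Finset.sum_eq_zero fun j hj => ?_
        by_contra hne
        have h3 := congrArg Finset.card (hsupp _ (right_ne_zero_of_mul hne))
        rw [Finset.card_insert_of_notMem (by simpa using hj), Finset.card_singleton] at h3
        exact hA (Finset.card_eq_zero.1 (by omega))
  rw [h2] at h1
  omega

end KoszulDuality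

end

noncomputable section

/-! ### Symmetry of the semigroup turned into duality; the Hilbert series -/

section Hilbert

variable {𝕂 : Type*} [Field 𝕂] {m : ℕ} {d : Fin m → ℕ}

theorem intMem_sub_iff {s : ℕ} (A : Finset (Fin m)) :
    (∃ t ∈ semigroupOf d, t + ∑ i ∈ A, d i = s) ↔ IntMem d ((s : ℤ) - ∑ i ∈ A, (d i : ℤ)) := by
  refine exists_congr fun t => and_congr_right fun _ => ?_
  rw [← Nat.cast_sum]
  omega

theorem intMem_of_lt {F : ℤ} (hF : ∀ n : ℤ, IntMem d n ↔ ¬ IntMem d (F - n)) {n : ℤ}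
    (hn : F < n) : IntMem d n := by
  rw [hF]
  rintro ⟨s, -, hs⟩
  omega

theorem finite_gaps (hsymm : IsSymmetricSemigroup d) : {s : ℕ | s ∉ semigroupOf d}.Finite := by
  obtain ⟨F, hF⟩ := hsymm
  refine (Set.finite_Iic F.toNat).subset fun s hs => ?_
  by_contra hlt
  rw [Set.mem_Iic, not_le] at hlt
  obtain ⟨t, ht, hts⟩ := intMem_of_lt hF (n := s) (by omega)
  obtain rfl : t = s := by exact_mod_cast hts
  exact hs ht

/-- Gorenstein duality: the graded Betti numbers of a symmetric semigroup are supported in degrees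
at most `N` and are symmetric. -/
theorem exists_gradedBetti_duality {n : ℕ} {d : Fin (n + 1) → ℕ} (hd : ∀ i, 0 < d i)
    (hsymm : IsSymmetricSemigroup d) :
    ∃ N : ℕ, (∀ k s, N < s → gradedBetti 𝕂 d k s = 0) ∧
      ∀ k l s s', k + l = n → s + s' = N → gradedBetti 𝕂 d k s = gradedBetti 𝕂 d l s' := by
  obtain ⟨F, hF⟩ := hsymm
  have hlarge : ∀ k s : ℕ, F + ∑ i, (d i : ℤ) < s → gradedBetti 𝕂 d k s = 0 := by
    intro k s hs
    refine gradedBetti_eq_zero_of_forall fun A _ => ?_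
    rw [intMem_sub_iff]
    have : ∑ i ∈ A, (d i : ℤ) ≤ ∑ i, (d i : ℤ) :=
      Finset.sum_le_sum_of_subset_of_nonneg (Finset.subset_univ _) fun _ _ _ => by positivity
    exact intMem_of_lt hF (by omega)
  have hle : ∀ k l s s' : ℕ, k + l = n → (s : ℤ) + s' = F + ∑ i, (d i : ℤ) →
      gradedBetti 𝕂 d k s ≤ gradedBetti 𝕂 d l s' := by
    intro k l s s' hkl hs
    refine gradedBetti_le_of_dual hkl fun A => ?_
    rw [intMem_sub_iff, intMem_sub_iff, hF]
    -- When `s + s' = F + ∑ d`, the reflection `n ↦ F - n` sends `s - ∑_A d` to `s'` minus the sum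
    -- over the complement of `A`.
    have := Finset.sum_add_sum_compl A fun i => (d i : ℤ)
    have e : F - ((s : ℤ) - ∑ i ∈ A, (d i : ℤ)) = (s' : ℤ) - ∑ i ∈ Aᶜ, (d i : ℤ) := by
      linarith
    rw [e]
  -- Were this negative, all Betti numbers would vanish, including the one of the unit in degree
  -- `0`.
  have hQ : 0 ≤ F + ∑ i, (d i : ℤ) := by
    by_contra hneg
    have h0 := hlarge 0 0 (by push_cast; omega)
    rw [gradedBetti_zero_zero hd] at h0
    exact one_ne_zero h0
  obtain ⟨N, hN⟩ := Int.eq_ofNat_of_zero_le hQ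
  refine ⟨N, fun k s hs => hlarge k s (by omega), fun k l s s' hkl hs => le_antisymm ?_ ?_⟩
  · exact hle k l s s' hkl (by omega)
  · exact hle l k s' s (by omega) (by omega)

open Classical in
/-- The numerator of the Hilbert series is the alternating sum of the Betti polynomials. -/
theorem hilbert_numerator {n N : ℕ} {d : Fin (n + 1) → ℕ}
    (hfin : {s : ℕ | s ∉ semigroupOf d}.Finite)
    (hN : ∀ k s, N < s → gradedBetti 𝕂 d k s = 0) :
    (1 - Polynomial.X : Polynomial ℂ) * ∑ k : Fin (n + 1), (-1) ^ (k : ℕ) *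
        ∑ s ∈ range (N + 1), (gradedBetti 𝕂 d k s : Polynomial ℂ) * Polynomial.X ^ s =
      (∏ i, (1 - Polynomial.X ^ d i)) *
        (1 - (1 - Polynomial.X) * ∑ s ∈ hfin.toFinset, Polynomial.X ^ s) := by
  apply Polynomial.coe_injective ℂ
  have hcoe : ∀ s : ℕ, ((Polynomial.X ^ s : Polynomial ℂ) : ℂ⟦X⟧) = X ^ s := by simp
  -- `H` is the Hilbert series of the semigroup ring. The gaps give `(1 - X) H` and the Koszul
  -- complex gives `∏ (1 - X^d) H`; eliminating `H` yields the identity.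
  let H : ℂ⟦X⟧ := PowerSeries.mk fun s => if s ∈ semigroupOf d then 1 else 0
  have hgap : (((1 - (1 - Polynomial.X) * ∑ s ∈ hfin.toFinset, Polynomial.X ^ s :
      Polynomial ℂ)) : ℂ⟦X⟧) = (1 - X) * H := by
    have h1 : H + ((∑ s ∈ hfin.toFinset, Polynomial.X ^ s : Polynomial ℂ) : ℂ⟦X⟧) =
        PowerSeries.mk 1 := by
      ext s
      simp only [H, map_add, coeff_mk, Polynomial.coeff_coe, Polynomial.finsetSum_coeff,
        Polynomial.coeff_X_pow, Finset.sum_ite_eq, Set.Finite.mem_toFinset, Set.mem_ofPred_eq,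
        Pi.one_apply]
      by_cases hs : s ∈ semigroupOf d <;> simp [hs]
    have h2 := PowerSeries.mk_one_mul_one_sub_eq_one ℂ
    rw [← h1] at h2
    push_cast [hcoe] at h2 ⊢
    linear_combination -h2
  have hnum : ((∑ k : Fin (n + 1), (-1) ^ (k : ℕ) *
        ∑ s ∈ range (N + 1), (gradedBetti 𝕂 d k s : Polynomial ℂ) * Polynomial.X ^ s :
        Polynomial ℂ) : ℂ⟦X⟧) = (∏ i, (1 - X ^ d i)) * H := by
    have hexp : (∏ i, (1 - X ^ d i) : ℂ⟦X⟧) =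
        ∑ A : Finset (Fin (n + 1)), (-1) ^ A.card * X ^ (∑ i ∈ A, d i) := by
      have := Finset.prod_add (fun i => -(X ^ d i : ℂ⟦X⟧)) (fun _ => 1) Finset.univ
      simp only [Finset.prod_const_one, mul_one, Finset.powerset_univ] at this
      simp only [sub_eq_neg_add]
      rw [this]
      refine Finset.sum_congr rfl fun A _ => ?_
      rw [Finset.prod_neg, Finset.prod_pow_eq_pow_sum]
    rw [hexp, Finset.sum_mul]
    ext s
    rw [Polynomial.coeff_coe, Polynomial.finsetSum_coeff, map_sum]
    have hl : ∀ k : Fin (n + 1), ((-1) ^ (k : ℕ) * ∑ s ∈ range (N + 1),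
        (gradedBetti 𝕂 d k s : Polynomial ℂ) * Polynomial.X ^ s : Polynomial ℂ).coeff s =
        (((-1 : ℤ) ^ (k : ℕ) * gradedBetti 𝕂 d k s : ℤ) : ℂ) := by
      intro k
      have e : ((-1) ^ (k : ℕ) : Polynomial ℂ) = Polynomial.C ((-1) ^ (k : ℕ)) := by simp
      rw [e, Polynomial.coeff_C_mul, Polynomial.finsetSum_coeff]
      push_cast
      congr 1
      simp only [← Polynomial.C_eq_natCast, Polynomial.coeff_C_mul, Polynomial.coeff_X_pow,
        mul_ite, mul_one, mul_zero, Finset.sum_ite_eq, Finset.mem_range]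
      split_ifs with h
      · rfl
      · rw [hN k s (by omega), Nat.cast_zero]
    rw [Finset.sum_congr rfl fun k _ => hl k, ← Int.cast_sum,
      sum_neg_one_pow_mul_gradedBetti, Int.cast_sum]
    refine Finset.sum_congr rfl fun A _ => ?_
    have e : ((-1) ^ A.card : ℂ⟦X⟧) = C ((-1) ^ A.card) := by simp
    rw [e, mul_assoc, coeff_C_mul, coeff_X_pow_mul', coeff_mk]
    by_cases hle : ∑ i ∈ A, d i ≤ s
    · rw [if_pos hle]
      have : (∃ t ∈ semigroupOf d, t + ∑ i ∈ A, d i = s) ↔ s - ∑ i ∈ A, d i ∈ semigroupOf d := by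
        constructor
        · rintro ⟨t, ht, rfl⟩
          simpa using ht
        · intro h
          exact ⟨_, h, Nat.sub_add_cancel hle⟩
      simp only [this]
      split_ifs <;> simp
    · rw [if_neg hle, if_neg]
      · simp
      · rintro ⟨t, -, rfl⟩
        omega
  rw [Polynomial.coe_mul, hnum, Polynomial.coe_mul, hgap]
  have hprod : ((∏ i, (1 - Polynomial.X ^ d i) : Polynomial ℂ) : ℂ⟦X⟧) = ∏ i, (1 - X ^ d i) := by
    rw [← Polynomial.coeToPowerSeries.ringHom_apply, map_prod]
    simp
  rw [hprod]
  push_cast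
  ring

end Hilbert

/-! ### Sorted listings of the syzygy degrees -/

section Rows

theorem card_filter_eq_count_ofFn {n : ℕ} (c : Fin n → ℕ) (s : ℕ) :
    (Finset.univ.filter fun j => c j = s).card = (List.ofFn c).count s := by
  rw [← Multiset.coe_count, ← Fin.univ_val_map, Multiset.count_map, Finset.card_def,
    Finset.filter_val]
  simp only [eq_comm]

/-- A finitely supported function `f` is the counting function of a sorted tuple. -/
theorem exists_monotone_card_eq (f : ℕ → ℕ) (N : ℕ) (hf : ∀ s, N < s → f s = 0) :
    ∃ c : Fin (∑ᶠ s, f s) → ℕ, Monotone c ∧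
      ∀ s, (Finset.univ.filter fun j => c j = s).card = f s := by
  let M : Multiset ℕ := ∑ s ∈ range (N + 1), Multiset.replicate (f s) s
  have hcount : ∀ s, M.count s = f s := by
    intro s
    simp only [M, Multiset.count_sum', Multiset.count_replicate, Finset.sum_ite_eq',
      Finset.mem_range]
    split_ifs with h
    · rfl
    · exact (hf s (by omega)).symm
  have hlen : (M.sort (· ≤ ·)).length = ∑ᶠ s, f s := by
    rw [Multiset.length_sort, finsum_eq_sum_of_support_subset (s := range (N + 1))]
    · simp [M]
    · intro s hs
      by_contra h
      exact hs (hf s (by simpa using h))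
  have hsort : (M.sort (· ≤ ·)).SortedLE := (Multiset.pairwise_sort M (· ≤ ·)).sortedLE
  have hcoe : ((M.sort (· ≤ ·) : List ℕ) : Multiset ℕ) = M := Multiset.sort_eq M (· ≤ ·)
  rw [← hlen]
  refine ⟨(M.sort (· ≤ ·)).get, hsort.monotone_get, fun s => ?_⟩
  rw [card_filter_eq_count_ofFn, List.ofFn_get, ← Multiset.coe_count, hcoe, hcount]

/-- A sorted listing is unique. This upgrades equality of multiplicities under `s ↦ N - s` to the
entrywise symmetry between reversed rows. -/
theorem eq_of_monotone_of_card_eq {n : ℕ} {c c' : Fin n → ℕ} (hc : Monotone c)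
    (hc' : Monotone c')
    (h : ∀ s, (Finset.univ.filter fun j => c j = s).card =
      (Finset.univ.filter fun j => c' j = s).card) : c = c' := by
  apply List.ofFn_injective
  refine List.Perm.eq_of_sortedLE hc.sortedLE_ofFn hc'.sortedLE_ofFn
    (List.perm_iff_count.2 fun s => ?_)
  rw [← card_filter_eq_count_ofFn, ← card_filter_eq_count_ofFn, h]

end Rows

/-! ### The semigroup as a point of the solution variety -/

section Point

theorem expSeries_add (a b : ℂ) : expSeries (a + b) = expSeries a * expSeries b :=
  (PowerSeries.exp_mul_exp_eq_exp_add a b).symm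

theorem coeff_expSeries (a : ℂ) (n : ℕ) : coeff n (expSeries a) = a ^ n / n.factorial := by
  simp [expSeries, coeff_rescale, coeff_exp, div_eq_mul_inv]

theorem expSeries_natCast (s : ℕ) : expSeries s = expSeries 1 ^ s := by
  have := PowerSeries.exp_pow_eq_rescale_exp (A := ℂ) s
  simp only [expSeries, rescale_one, RingHom.id_apply]
  exact this.symm

variable {𝕂 : Type*} [Field 𝕂] {m : ℕ} {d : Fin m → ℕ}

theorem genus_eq_sum (hfin : {s : ℕ | s ∉ semigroupOf d}.Finite) (r : ℕ) :
    genus d r = ∑ s ∈ hfin.toFinset, s ^ r :=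
  finsum_mem_eq_finite_toFinset_sum _ hfin

theorem betti_zero (hd : ∀ i, 0 < d i) : betti 𝕂 d 0 = 1 := by
  rw [betti, finsum_eq_single _ 0 fun s hs => gradedBetti_zero_of_ne_zero hs,
    gradedBetti_zero_zero hd]

theorem betti_eq_of_add_eq {n k l : ℕ} {d : Fin (n + 1) → ℕ} (hd : ∀ i, 0 < d i)
    (hsymm : IsSymmetricSemigroup d) (hkl : k + l = n) : betti 𝕂 d k = betti 𝕂 d l := by
  obtain ⟨N, hN, hdual⟩ := exists_gradedBetti_duality (𝕂 := 𝕂) hd hsymm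
  have hs : ∀ k, betti 𝕂 d k = ∑ s ∈ range (N + 1), gradedBetti 𝕂 d k s := by
    intro k
    refine finsum_eq_sum_of_support_subset _ fun s hs => ?_
    by_contra h
    exact hs (hN k s (by simpa using h))
  rw [hs, hs, ← Finset.sum_range_reflect]
  refine Finset.sum_congr rfl fun s hs' => ?_
  have := Finset.mem_range.1 hs'
  exact hdual k l _ _ hkl (by omega)

/-- The degrees of syzygies of a symmetric semigroup and its genera are a point of the solution
variety. -/
theorem exists_syzygySolution (hm : 0 < m) (hd : ∀ i, 0 < d i)
    (hsymm : IsSymmetricSemigroup d) :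
    ∃ w : SyzygySolution d (betti 𝕂 d),
      (∀ (k : Fin m) (s : ℕ), Nat.card {j // w.C k j = s} = gradedBetti 𝕂 d k s) ∧
      ∀ r : ℕ, w.G r = genus d r := by
  obtain ⟨n, rfl⟩ : ∃ n, m = n + 1 := ⟨m - 1, by omega⟩
  have hfin := finite_gaps hsymm
  obtain ⟨N, hN, hdual⟩ := exists_gradedBetti_duality (𝕂 := 𝕂) hd hsymm
  have hrows : ∀ k, ∃ c : Fin (betti 𝕂 d k) → ℕ, Monotone c ∧
      ∀ s, (Finset.univ.filter fun j => c j = s).card = gradedBetti 𝕂 d k s := fun k =>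
    exists_monotone_card_eq (fun s => gradedBetti 𝕂 d k s) N (hN k)
  choose c hmono hcard using hrows
  have hle : ∀ k j, c k j ≤ N := by
    intro k j
    by_contra hlt
    have h1 := hcard k (c k j)
    rw [hN k _ (by omega), Finset.card_eq_zero, Finset.filter_eq_empty_iff] at h1
    exact h1 (Finset.mem_univ j) rfl
  have hb : ∀ k l, k + l = n → betti 𝕂 d k = betti 𝕂 d l := fun k l =>
    betti_eq_of_add_eq hd hsymm
  have hrev : ∀ k l (hkl : k + l = n) (j : Fin (betti 𝕂 d k)) (j' : Fin (betti 𝕂 d l)),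
      (j : ℕ) + j' + 1 = betti 𝕂 d k → c k j + c l j' = N := by
    intro k l hkl j j' hj
    let e : Fin (betti 𝕂 d k) ≃ Fin (betti 𝕂 d l) := Fin.revPerm.trans (finCongr (hb k l hkl))
    have he : c k = fun j => N - c l (e j) := by
      refine eq_of_monotone_of_card_eq (hmono k) ?_ fun s => ?_
      · intro a b hab
        refine Nat.sub_le_sub_left (hmono l ?_) N
        simpa [e, Fin.le_def] using Nat.sub_le_sub_left (Nat.succ_le_succ hab) _
      · rw [hcard]
        by_cases hs : s ≤ N
        · rw [hdual k l s (N - s) hkl (by omega), ← hcard l]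
          refine Finset.card_equiv e.symm fun i => ?_
          have := hle l i
          simp only [Finset.mem_filter, Finset.mem_univ, true_and, Equiv.apply_symm_apply]
          omega
        · rw [hN k s (by omega), eq_comm, Finset.card_eq_zero, Finset.filter_eq_empty_iff]
          intro j _
          omega
    have hej : e j = j' := by
      ext
      simp only [e, Equiv.trans_apply, Fin.revPerm_apply, finCongr_apply, Fin.val_cast,
        Fin.val_rev]
      omega
    have h1 := congrFun he j
    have h2 := hle l j'
    rw [hej] at h1
    omega
  refine ⟨{ C := fun k j => c k j
            Q := N
            G := fun r => genus d r
            zero_row := ?_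
            symm := ?_
            hilbert := ?_ }, ?_, fun r => rfl⟩
  · intro k j hk
    by_contra hne
    have h1 := hcard k (c k j)
    have h0 : ∀ k s, k = 0 → s ≠ 0 → gradedBetti 𝕂 d k s = 0 := by
      rintro _ s rfl hs
      exact gradedBetti_zero_of_ne_zero hs
    have h2 := h0 k (c k j) hk (by exact_mod_cast hne)
    rw [h2, Finset.card_eq_zero,
      Finset.filter_eq_empty_iff] at h1
    exact h1 (Finset.mem_univ _) rfl
  · intro k l j j' hkl hj
    exact_mod_cast hrev k l (by omega) j j' hj
  · have h1 := congrArg (Polynomial.aeval (expSeries 1)) (hilbert_numerator hfin hN)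
    simp only [map_mul, map_sub, map_one, map_sum, map_prod, map_pow, map_neg, map_natCast,
      Polynomial.aeval_X, ← expSeries_natCast] at h1
    have h2 : ∀ k : Fin (n + 1), ∑ j, expSeries (c k j) =
        ∑ s ∈ range (N + 1), (gradedBetti 𝕂 d k s : ℂ⟦X⟧) * expSeries s := by
      intro k
      rw [← Finset.sum_fiberwise_of_maps_to (t := range (N + 1)) (g := c k)]
      · refine Finset.sum_congr rfl fun s _ => ?_
        rw [← hcard k s, ← nsmul_eq_mul, ← Finset.sum_const]
        refine Finset.sum_congr rfl fun j hj => ?_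
        rw [(Finset.mem_filter.1 hj).2]
      · intro j _
        have := hle k j
        rw [Finset.mem_range]
        omega
    have h3 : (PowerSeries.mk fun r => (genus d r : ℂ) / (r.factorial : ℂ)) =
        ∑ s ∈ hfin.toFinset, expSeries s := by
      ext r
      rw [coeff_mk, map_sum, genus_eq_sum hfin]
      simp only [coeff_expSeries, Nat.cast_sum, Nat.cast_pow, Finset.sum_div]
    rw [h3]
    simp only [h2]
    exact h1
  · intro k s
    rw [← hcard k s, Nat.card_eq_fintype_card, Fintype.card_subtype]
    simp

end Point

end

noncomputable section

/-! ### Vandermonde arguments for weighted power sums -/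

section PowerSums

/-- Vandermonde: moments of vectors at distinct nodes determine the vectors. -/
theorem eq_zero_of_forall_sum_pow_smul_eq_zero {K M ι : Type*} [Field K] [AddCommGroup M]
    [Module K M] {T : Finset ι} {x : ι → K} (hx : Set.InjOn x T) {v : ι → M}
    (h : ∀ i < T.card, ∑ j ∈ T, x j ^ i • v j = 0) : ∀ j ∈ T, v j = 0 := by
  classical
  intro j hj
  -- The unnormalized Lagrange polynomial isolates the node `x j`, and its degree is below the
  -- number of vanishing moments.
  let f : Polynomial K := ∏ l ∈ T.erase j, (Polynomial.X - Polynomial.C (x l))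
  have hdeg : f.natDegree < T.card := by
    rw [Polynomial.natDegree_prod_of_monic _ _ fun l _ => Polynomial.monic_X_sub_C _]
    simp only [Polynomial.natDegree_X_sub_C, Finset.sum_const, smul_eq_mul, mul_one]
    exact Finset.card_erase_lt_of_mem hj
  have hsum : ∑ l ∈ T, f.eval (x l) • v l = 0 := by
    simp only [Polynomial.eval_eq_sum_range, Finset.sum_smul]
    rw [Finset.sum_comm]
    refine Finset.sum_eq_zero fun i hi => ?_
    simp only [mul_smul]
    rw [← Finset.smul_sum, h i (by rw [Finset.mem_range] at hi; omega), smul_zero]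
  rw [Finset.sum_eq_single_of_mem j hj] at hsum
  · refine (smul_eq_zero.1 hsum).resolve_left ?_
    rw [Polynomial.eval_prod]
    refine Finset.prod_ne_zero_iff.2 fun l hl => ?_
    rw [Polynomial.eval_sub, Polynomial.eval_X, Polynomial.eval_C, sub_ne_zero]
    exact fun e => (Finset.mem_erase.1 hl).1 (hx (Finset.mem_erase.1 hl).2 hj e.symm)
  · intro l hl hlj
    rw [Polynomial.eval_prod, Finset.prod_eq_zero (Finset.mem_erase.2 ⟨hlj, hl⟩) (by simp),
      zero_smul]

/-- If the first `p` weighted power sums vanish and the next one does not, then there are at least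
`p + 1` distinct nodes with nonzero weights. -/
theorem exists_card_eq_of_sum_pow {K J : Type*} [Field K] [Fintype J] {c y : J → K} {a p : ℕ}
    (ha : a ≠ 0) (h0 : ∀ i < p, ∑ j, c j * y j ^ (2 * i + a) = 0)
    (h1 : ∑ j, c j * y j ^ (2 * p + a) ≠ 0) :
    ∃ T : Finset J, T.card = p + 1 ∧ Set.InjOn (fun j => y j ^ 2) T ∧
      ∀ j ∈ T, c j ≠ 0 ∧ y j ≠ 0 := by
  classical
  let N : Finset J := Finset.univ.filter fun j => c j ≠ 0 ∧ y j ≠ 0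
  let Z : Finset K := N.image fun j => y j ^ 2
  have hZ : p + 1 ≤ Z.card := by
    by_contra hlt
    -- With at most `p` distinct nonzero squares some monic `f` of degree exactly `p` vanishes on
    -- all of them, the power of `X` padding the degree. Summing `f` against the weights expresses
    -- the top power sum through the lower, vanishing ones.
    let f : Polynomial K :=
      Polynomial.X ^ (p - Z.card) * ∏ z ∈ Z, (Polynomial.X - Polynomial.C z)
    have hm : (∏ z ∈ Z, (Polynomial.X - Polynomial.C z)).Monic :=
      Polynomial.monic_prod_of_monic _ _ fun z _ => Polynomial.monic_X_sub_C _
    have hdeg : f.natDegree = p := by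
      rw [Polynomial.Monic.natDegree_mul (Polynomial.monic_X_pow _) hm,
        Polynomial.natDegree_X_pow,
        Polynomial.natDegree_prod_of_monic _ _ fun l _ => Polynomial.monic_X_sub_C _]
      simp only [Polynomial.natDegree_X_sub_C, Finset.sum_const, smul_eq_mul, mul_one]
      omega
    have hcoeff : f.coeff p = 1 := by
      have := ((Polynomial.monic_X_pow (R := K) (p - Z.card)).mul hm).coeff_natDegree
      rwa [hdeg] at this
    have hsum : ∑ j, c j * y j ^ a * f.eval (y j ^ 2) = 0 := by
      refine Finset.sum_eq_zero fun j _ => ?_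
      by_cases hj : j ∈ N
      · have : f.eval (y j ^ 2) = 0 := by
          rw [Polynomial.eval_mul, Polynomial.eval_prod,
            Finset.prod_eq_zero (Finset.mem_image_of_mem _ hj) (by simp), mul_zero]
        rw [this, mul_zero]
      · simp only [N, Finset.mem_filter, Finset.mem_univ, true_and, not_and_or, not_not] at hj
        rcases hj with hj | hj
        · rw [hj, zero_mul, zero_mul]
        · rw [hj, zero_pow ha, mul_zero, zero_mul]
    apply h1
    simp only [Polynomial.eval_eq_sum_range, Finset.mul_sum, hdeg] at hsum
    rw [Finset.sum_comm, Finset.sum_range_succ] at hsum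
    rw [Finset.sum_eq_zero, zero_add, hcoeff] at hsum
    · rw [← hsum]
      refine Finset.sum_congr rfl fun j _ => ?_
      ring
    · intro i hi
      rw [← mul_zero (f.coeff i), ← h0 i (Finset.mem_range.1 hi), Finset.mul_sum]
      refine Finset.sum_congr rfl fun j _ => ?_
      ring
  obtain ⟨T, hT, hinj, himg⟩ := Finset.exists_subset_injOn_image_eq_of_surjOn
    (f := fun j => y j ^ 2) (N : Set J) Z (by
      intro z hz
      simpa [Z] using hz)
  have hTcard : T.card = Z.card := by
    rw [← himg, Finset.card_image_of_injOn hinj]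
  obtain ⟨T', hT', hcard⟩ := Finset.exists_subset_card_eq (hTcard ▸ hZ)
  refine ⟨T', hcard, hinj.mono (by exact_mod_cast hT'), fun j hj => ?_⟩
  have := hT (hT' hj)
  simpa [N] using this

/-- Nodes whose weighted power sums lie in the base field are algebraic over it. -/
theorem isAlgebraic_of_sum_pow_mem {E K ι : Type*} [Field E] [Field K] [Algebra E K] [CharZero E]
    {T : Finset ι} {y : ι → K} {c : ι → E} {a : ℕ} (ha : a ≠ 0)
    (hinj : Set.InjOn (fun j => y j ^ 2) T) (hy : ∀ j ∈ T, y j ≠ 0) (hc : ∀ j ∈ T, c j ≠ 0)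
    (hmem : ∀ i < T.card,
      ∑ j ∈ T, algebraMap E K (c j) * y j ^ (2 * i + a) ∈ (algebraMap E K).range) :
    ∀ j ∈ T, IsAlgebraic E (y j) := by
  classical
  let L := IntermediateField.adjoin E (y '' T)
  have hyL : ∀ j ∈ T, y j ∈ L := fun j hj =>
    IntermediateField.subset_adjoin _ _ ⟨j, hj, rfl⟩
  let z : ι → L := fun j => if h : j ∈ T then ⟨y j, hyL j h⟩ else 0
  have hz : ∀ j ∈ T, ((z j : L) : K) = y j := fun j hj => by simp [z, hj]
  have : CharZero L := charZero_of_injective_algebraMap (algebraMap E L).injective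
  -- Differentiating the power sums gives a Vandermonde system in the squares `z j ^ 2`, which
  -- forces every `D (z j)` to vanish.
  let D := KaehlerDifferential.D E L
  have hzD : ∀ j ∈ T, D (z j) = 0 := by
    have hxinj : Set.InjOn (fun j => z j ^ 2) T := by
      intro j hj l hl e
      refine hinj hj hl ?_
      have := congrArg (algebraMap L K) e
      simpa [IntermediateField.algebraMap_apply, hz j hj, hz l hl] using this
    have key := eq_zero_of_forall_sum_pow_smul_eq_zero (K := L) hxinj
      (v := fun j => (algebraMap E L (c j) * z j ^ (a - 1)) • D (z j)) ?_
    · intro j hj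
      refine (smul_eq_zero.1 (key j hj)).resolve_left (mul_ne_zero ?_ (pow_ne_zero _ ?_))
      · rw [Ne, _root_.map_eq_zero]
        exact hc j hj
      · intro e
        have := congrArg (algebraMap L K) e
        rw [IntermediateField.algebraMap_apply, hz j hj, map_zero] at this
        exact hy j hj this
    · intro i hi
      obtain ⟨e, he⟩ := hmem i hi
      have h1 : ∑ j ∈ T, algebraMap E L (c j) * z j ^ (2 * i + a) = algebraMap E L e := by
        apply (algebraMap L K).injective
        rw [← IsScalarTower.algebraMap_apply, he, map_sum]
        refine Finset.sum_congr rfl fun j hj => ?_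
        rw [map_mul, map_pow, ← IsScalarTower.algebraMap_apply,
          IntermediateField.algebraMap_apply, hz j hj]
      have h2 := congrArg D h1
      rw [Derivation.map_algebraMap, map_sum] at h2
      have hne : ((2 * i + a : ℕ) : L) ≠ 0 := by
        rw [Nat.cast_ne_zero]
        omega
      have h3 : ((2 * i + a : ℕ) : L) • ∑ j ∈ T, (z j ^ 2) ^ i •
          (algebraMap E L (c j) * z j ^ (a - 1)) • D (z j) = 0 := by
        rw [← h2, Finset.smul_sum]
        refine Finset.sum_congr rfl fun j _ => ?_
        rw [Derivation.leibniz, Derivation.map_algebraMap, smul_zero, add_zero,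
          Derivation.leibniz_pow, ← Nat.cast_smul_eq_nsmul L, smul_smul, smul_smul, smul_smul,
          smul_smul]
        congr 1
        rw [show 2 * i + a - 1 = 2 * i + (a - 1) by omega, pow_add, pow_mul]
        ring
      exact (smul_eq_zero.1 h3).resolve_left hne
  have hD : ∀ x : L, D x = 0 := by
    rintro ⟨x, hx⟩
    induction hx using IntermediateField.adjoin_induction with
    | mem x hx =>
      obtain ⟨j, hj, rfl⟩ := hx
      have : (⟨y j, hyL j hj⟩ : L) = z j := Subtype.ext (hz j hj).symm
      rw [this]
      exact hzD j hj
    | algebraMap x => exact Derivation.map_algebraMap D x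
    | add x y hx hy ihx ihy =>
      have := D.map_add ⟨x, hx⟩ ⟨y, hy⟩
      rw [ihx, ihy, add_zero] at this
      exact this
    | inv x hx ih =>
      have := D.leibniz_inv ⟨x, hx⟩
      rw [ih, smul_zero] at this
      exact this
    | mul x y hx hy ihx ihy =>
      have := D.leibniz ⟨x, hx⟩ ⟨y, hy⟩
      rw [ihx, ihy, smul_zero, smul_zero, add_zero] at this
      exact this
  -- A finitely generated field extension without differentials is separable algebraic.
  have : Algebra.FormallyUnramified E L := by
    constructor
    rw [← Submodule.subsingleton_iff L, ← subsingleton_iff_bot_eq_top,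
      ← KaehlerDifferential.span_range_derivation, eq_comm, Submodule.span_eq_bot]
    rintro _ ⟨x, rfl⟩
    exact hD x
  have : Algebra.EssFiniteType E L := by
    rw [IntermediateField.essFiniteType_iff]
    exact IntermediateField.fg_adjoin_of_finite (T.finite_toSet.image y)
  have := Algebra.FormallyUnramified.isSeparable E L
  intro j hj
  have h := (Algebra.IsSeparable.isSeparable E (z j)).isIntegral.isAlgebraic
  have := h.algebraMap (A := K)
  rwa [IntermediateField.algebraMap_apply, hz j hj] at this

end PowerSums

/-! ### Transcendence degree as rank in the algebraic independence matroid -/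

section TranscendenceDegree

variable {k K : Type*} [Field k] [Field K] [Algebra k K]

open scoped IntermediateField.algebraAdjoinAdjoin in
theorem mem_matroid_closure_iff {S : Set K} {x : K} :
    x ∈ (AlgebraicIndependent.matroid k K).closure S ↔
      IsAlgebraic (IntermediateField.adjoin k S) x := by
  rw [AlgebraicIndependent.matroid_closure_eq, SetLike.mem_coe, Subalgebra.mem_algebraicClosure]
  exact IsFractionRing.isAlgebraic_iff (Algebra.adjoin k S) (IntermediateField.adjoin k S) K

theorem card_le_of_algebraicIndependent {ι : Type*} [Fintype ι] {x : ι → K}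
    (hx : AlgebraicIndependent k x) {S : Finset K}
    (h : ∀ i, x i ∈ (AlgebraicIndependent.matroid k K).closure S) :
    Fintype.card ι ≤ S.card := by
  have h1 : (AlgebraicIndependent.matroid k K).Indep (Set.range x) :=
    AlgebraicIndependent.matroid_indep_iff.2 hx.to_subtype_range
  have h2 := h1.encard_le_eRk_of_subset (Set.range_subset_iff.2 h)
  rw [Matroid.eRk_closure_eq] at h2
  have h3 := h2.trans (Matroid.eRk_le_encard _ _)
  have h4 : (Set.range x).encard = Fintype.card ι := by
    rw [← Set.image_univ, hx.injective.encard_image, Set.encard_univ, ENat.card_eq_coe_fintype_card]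
  rw [h4, Set.encard_coe_eq_coe_finsetCard] at h3
  exact_mod_cast h3

/-- The family `z` spans rank at least the number of the `x`, hence at least its own length; a
spanning family no longer than the rank is independent. -/
theorem algebraicIndependent_of_mem_closure {ι κ : Type*} [Fintype ι] [Fintype κ] {x : ι → K}
    (hx : AlgebraicIndependent k x) {z : κ → K} (hcard : Fintype.card κ ≤ Fintype.card ι)
    (h : ∀ i, x i ∈ (AlgebraicIndependent.matroid k K).closure (Set.range z)) :
    AlgebraicIndependent k z := by
  have h1 : (AlgebraicIndependent.matroid k K).Indep (Set.range x) :=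
    AlgebraicIndependent.matroid_indep_iff.2 hx.to_subtype_range
  have h2 := h1.encard_le_eRk_of_subset (Set.range_subset_iff.2 h)
  rw [Matroid.eRk_closure_eq] at h2
  have h4 : (Set.range x).encard = Fintype.card ι := by
    rw [← Set.image_univ, hx.injective.encard_image, Set.encard_univ, ENat.card_eq_coe_fintype_card]
  rw [h4] at h2
  have h5 : (Set.range z).encard ≤ Fintype.card κ := by
    rw [← Set.image_univ, ← ENat.card_eq_coe_fintype_card, ← Set.encard_univ]
    exact Set.encard_image_le _ _
  have h6 : ((Fintype.card κ : ℕ) : ℕ∞) ≤ Fintype.card ι := by exact_mod_cast hcard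
  have h7 := h5.trans (h6.trans h2)
  -- A repetition in `z` would leave fewer elements than the rank.
  have hinj : Function.Injective z := by
    have h8 : (Set.univ : Set κ).encard ≤ (z '' Set.univ).encard := by
      rw [Set.encard_univ, ENat.card_eq_coe_fintype_card, Set.image_univ]
      exact h6.trans (h2.trans (Matroid.eRk_le_encard _ _))
    rw [← Set.injOn_univ]
    exact Set.finite_univ.injOn_of_encard_image_eq (le_antisymm (Set.encard_image_le _ _) h8)
  have h9 : (AlgebraicIndependent.matroid k K).Indep (Set.range z) :=
    (Matroid.indep_iff_eRk_eq_encard_of_finite (Set.finite_range z)).2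
      (le_antisymm (Matroid.eRk_le_encard _ _) h7)
  rw [AlgebraicIndependent.matroid_indep_iff] at h9
  exact (algebraicIndependent_subtype_range hinj).1 h9

end TranscendenceDegree

end

noncomputable section

/-! ### Passing from rings of functions to fields -/

section Specialization

variable {k : Type*} [Field k]

/-- Algebraic independence in a commutative algebra is witnessed in a field. -/
theorem exists_algHom_field_algebraicIndependent {R : Type*} [CommRing R] [Algebra k R]
    {ι : Type*} {f : ι → R} (hf : AlgebraicIndependent k f) :
    ∃ (P : Ideal R) (_ : P.IsPrime) (φ : R →ₐ[k] FractionRing (R ⧸ P)),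
      AlgebraicIndependent k (φ ∘ f) := by
  -- The values of nonzero polynomials at `f` are a multiplicative set, and by independence it
  -- avoids `0`. Modulo a prime disjoint from it the family stays independent.
  let S : Submonoid R := (nonZeroDivisors (MvPolynomial ι k)).map (MvPolynomial.aeval f)
  have hdisj : Disjoint ((⊥ : Ideal R) : Set R) S := by
    rw [Set.disjoint_left]
    rintro x hx ⟨p, hp, hpx⟩
    have hx0 : x = 0 := by simpa using hx
    rw [hx0] at hpx
    exact nonZeroDivisors.ne_zero hp (hf.eq_zero_of_aeval_eq_zero p hpx)
  obtain ⟨P, hP, -, hPS⟩ := Ideal.exists_le_prime_disjoint _ S hdisj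
  let φ : R →ₐ[k] FractionRing (R ⧸ P) :=
    (IsScalarTower.toAlgHom k (R ⧸ P) (FractionRing (R ⧸ P))).comp (Ideal.Quotient.mkₐ k P)
  refine ⟨P, hP, φ, ?_⟩
  rw [algebraicIndependent_iff]
  intro p hp
  by_contra hne
  have hcomp : MvPolynomial.aeval (φ ∘ f) = φ.comp (MvPolynomial.aeval f) := by
    ext
    simp
  rw [hcomp] at hp
  have h1 : algebraMap (R ⧸ P) (FractionRing (R ⧸ P))
      (Ideal.Quotient.mk P (MvPolynomial.aeval f p)) = 0 := hp
  rw [map_eq_zero_iff _ (IsFractionRing.injective _ _), Ideal.Quotient.eq_zero_iff_mem] at h1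
  exact Set.disjoint_left.1 hPS h1 ⟨p, mem_nonZeroDivisors_of_ne_zero hne, rfl⟩

end Specialization

/-! ### Dimension bound for nodes with prescribed signed power sums -/

section TranscendenceDegree

variable {k K : Type*} [Field k] [Field K] [Algebra k K]

theorem subset_matroid_closure (S : Set K) : S ⊆ (AlgebraicIndependent.matroid k K).closure S :=
  Matroid.subset_closure _ S (Set.subset_univ S)

theorem adjoin_subset_matroid_closure {S : Set K} {x : K} (hx : x ∈ Algebra.adjoin k S) :
    x ∈ (AlgebraicIndependent.matroid k K).closure S := by
  rw [mem_matroid_closure_iff]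
  exact isAlgebraic_algebraMap
    (⟨x, IntermediateField.algebra_adjoin_le_adjoin k S hx⟩ : IntermediateField.adjoin k S)

theorem matroid_closure_trans {S Y : Set K} {x : K}
    (hx : x ∈ (AlgebraicIndependent.matroid k K).closure Y)
    (hY : ∀ y ∈ Y, y ∈ (AlgebraicIndependent.matroid k K).closure S) :
    x ∈ (AlgebraicIndependent.matroid k K).closure S :=
  Matroid.closure_subset_closure_of_subset_closure hY hx

/-- Nodes with signed power sums as prescribed by constants generate a field of transcendence degree
at most the number of nodes minus the number of equations, and strictly less if the squares of the
nodes are not distinct and nonzero. -/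
theorem exists_subset_closure_of_sum_pow [CharZero k] {J : Type*} [Fintype J] {ε : J → ℤ}
    {y : J → K} {a p : ℕ} {c : k} (ha : a ≠ 0) (hc : c ≠ 0)
    (h0 : ∀ i < p, ∑ j, (ε j : K) * y j ^ (2 * i + a) = 0)
    (h1 : ∑ j, (ε j : K) * y j ^ (2 * p + a) = algebraMap k K c) :
    ∃ S : Finset J, S.card + (p + 1) ≤ Fintype.card J ∧
      (∀ j, y j ∈ (AlgebraicIndependent.matroid k K).closure (y '' S)) ∧
      (S.card + (p + 1) = Fintype.card J →
        Function.Injective (fun j => y j ^ 2) ∧ ∀ j, y j ≠ 0) := by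
  classical
  have : CharZero K := charZero_of_injective_algebraMap (algebraMap k K).injective
  have hne : ∑ j, (ε j : K) * y j ^ (2 * p + a) ≠ 0 := by
    rw [h1, Ne, _root_.map_eq_zero]
    exact hc
  have hJ : Nonempty J := by
    by_contra hemp
    rw [not_nonempty_iff] at hemp
    exact hne (by simp)
  -- Nodes are grouped by their squares: `r j` represents the class of `j`, and `y j` equals `y (r
  -- j)` up to the sign `s j`.
  let r : J → J := fun j => Function.invFun (fun j => y j ^ 2) (y j ^ 2)
  have hr : ∀ j, y (r j) ^ 2 = y j ^ 2 := fun j =>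
    Function.invFun_eq (f := fun j => y j ^ 2) ⟨j, rfl⟩
  have hr_congr : ∀ j l, y j ^ 2 = y l ^ 2 → r j = r l := fun j l e => by
    simp only [r, e]
  let s : J → ℤ := fun j => if y j = y (r j) then 1 else -1
  have hs : ∀ j, y j = s j * y (r j) := by
    intro j
    by_cases h : y j = y (r j)
    · simp [s, ← h]
    · have := (sq_eq_sq_iff_eq_or_eq_neg.1 (hr j).symm).resolve_left h
      simp only [s, if_neg h]
      push_cast
      linear_combination this
  let N : J → Finset J := fun i => Finset.univ.filter fun j => y j ≠ 0 ∧ r j = i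
  -- Since `s j ^ (2 * i + a) = s j ^ a`, the same merged weights serve every exponent. They may
  -- cancel, which is why `T` below is chosen among nonzero weights.
  let w : J → ℤ := fun i => ∑ j ∈ N i, ε j * s j ^ a
  have hs2 : ∀ j, (s j) ^ 2 = 1 := by
    intro j
    by_cases h : y j = y (r j) <;> simp [s, h]
  have hw : ∀ i, ∑ j, (w j : K) * y j ^ (2 * i + a) = ∑ j, (ε j : K) * y j ^ (2 * i + a) := by
    intro i
    rw [← Finset.sum_filter_add_sum_filter_not Finset.univ (fun j => y j ≠ 0)
      (fun j => (ε j : K) * y j ^ (2 * i + a))]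
    rw [Finset.sum_eq_zero (s := Finset.univ.filter fun j => ¬ y j ≠ 0), add_zero,
      ← Finset.sum_fiberwise (Finset.univ.filter fun j => y j ≠ 0) r]
    · refine Finset.sum_congr rfl fun l _ => ?_
      rw [Finset.filter_filter]
      simp only [w, N]
      push_cast
      rw [Finset.sum_mul]
      refine Finset.sum_congr rfl fun j hj => ?_
      obtain ⟨-, -, rfl⟩ := Finset.mem_filter.1 hj
      conv_rhs => rw [hs j, mul_pow, pow_add, pow_mul]
      have : (s j : K) ^ 2 = 1 := by exact_mod_cast hs2 j
      rw [this, one_pow]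
      ring
    · intro j hj
      have : y j = 0 := by simpa using hj
      rw [this, zero_pow (by omega), mul_zero]
  obtain ⟨T, hTcard, hTinj, hT⟩ := exists_card_eq_of_sum_pow (c := fun j => (w j : K)) (y := y)
    (p := p) ha (fun i hi => (hw i).trans (h0 i hi)) (by rw [hw]; exact hne)
  let R : Finset J := (Finset.univ.filter fun j => y j ≠ 0).image r
  have hwR : ∀ i, w i ≠ 0 → i ∈ R := by
    intro i hi
    obtain ⟨j, hj, -⟩ := Finset.exists_ne_zero_of_sum_ne_zero hi
    have hj' := Finset.mem_filter.1 hj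
    exact Finset.mem_image.2 ⟨j, by simp [hj'.2.1], hj'.2.2⟩
  have hTR : T ⊆ R := fun i hi => hwR i (by exact_mod_cast (hT i hi).1)
  have hRinj : Set.InjOn (fun j => y j ^ 2) R := by
    intro i hi l hl e
    obtain ⟨i, -, rfl⟩ := Finset.mem_image.1 hi
    obtain ⟨l, -, rfl⟩ := Finset.mem_image.1 hl
    simp only [hr] at e
    exact hr_congr _ _ e
  have hR0 : ∀ j ∈ R, y j ≠ 0 := by
    intro j hj
    obtain ⟨i, hi, rfl⟩ := Finset.mem_image.1 hj
    have hi0 : y i ≠ 0 := by simpa using hi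
    intro h
    have := hr i
    rw [h, zero_pow two_ne_zero] at this
    exact pow_ne_zero 2 hi0 this.symm
  have hcard : (R \ T).card + (p + 1) = R.card := by
    rw [← hTcard, Finset.card_sdiff_add_card_eq_card hTR]
  -- The `p + 1` power sums make the nodes in `T` algebraic over the other representatives; all
  -- remaining nodes are zero or signed copies. Equality of cardinalities forces every node to be a
  -- representative.
  refine ⟨R \ T, hcard.trans_le (Finset.card_le_univ R), ?_, ?_⟩
  · let E := IntermediateField.adjoin k (y '' (R \ T : Finset J))
    have hE : ∀ j ∈ R \ T, y j ∈ E := fun j hj =>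
      IntermediateField.subset_adjoin _ _ ⟨j, by exact_mod_cast hj, rfl⟩
    have : CharZero E := charZero_of_injective_algebraMap (algebraMap k E).injective
    have hTalg : ∀ j ∈ T, IsAlgebraic E (y j) := by
      refine isAlgebraic_of_sum_pow_mem (c := fun j => (w j : E)) ha hTinj
        (fun j hj => (hT j hj).2) (fun j hj => ?_) fun i hi => ?_
      · have := (hT j hj).1
        rw [Int.cast_ne_zero] at this ⊢
        exact this
      · have hconst : ∑ j, (w j : K) * y j ^ (2 * i + a) ∈ E := by
          rw [hw]
          rcases Nat.lt_succ_iff_lt_or_eq.1 (hTcard ▸ hi : i < p + 1) with h | rfl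
          · rw [h0 i h]
            exact zero_mem _
          · rw [h1]
            exact E.algebraMap_mem c
        have hsplit : ∑ j, (w j : K) * y j ^ (2 * i + a) =
            ∑ j ∈ R \ T, (w j : K) * y j ^ (2 * i + a) +
              ∑ j ∈ T, (w j : K) * y j ^ (2 * i + a) := by
          rw [Finset.sum_sdiff hTR]
          refine (Finset.sum_subset (Finset.subset_univ R) fun j _ hj => ?_).symm
          have : w j = 0 := by
            by_contra h
            exact hj (hwR j h)
          rw [this, Int.cast_zero, zero_mul]
        have hmem : ∑ j ∈ T, (w j : K) * y j ^ (2 * i + a) ∈ E := by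
          rw [hsplit] at hconst
          refine (add_mem_cancel_left (sum_mem fun j hj => ?_)).1 hconst
          exact mul_mem (intCast_mem _ _) (pow_mem (hE j hj) _)
        refine ⟨⟨_, hmem⟩, ?_⟩
        simp [IntermediateField.algebraMap_apply]
    have hRcl : ∀ j ∈ R, y j ∈ (AlgebraicIndependent.matroid k K).closure
        (y '' (R \ T : Finset J)) := by
      intro j hj
      by_cases hjT : j ∈ T
      · exact mem_matroid_closure_iff.2 (hTalg j hjT)
      · exact subset_matroid_closure _
          ⟨j, by exact_mod_cast Finset.mem_sdiff.2 ⟨hj, hjT⟩, rfl⟩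
    intro j
    rw [mem_matroid_closure_iff]
    by_cases hj : y j = 0
    · rw [hj]
      exact isAlgebraic_zero
    · rw [hs j]
      have h2 := mem_matroid_closure_iff.1
        (hRcl (r j) (Finset.mem_image.2 ⟨j, by simp [hj], rfl⟩))
      exact (isAlgebraic_intCast (s j)).mul h2
  · intro he
    have hRuniv : R = Finset.univ := Finset.eq_univ_of_card _ (by omega)
    refine ⟨fun i j e => hRinj ?_ ?_ e, fun j => hR0 j ?_⟩ <;> simp [hRuniv]

end TranscendenceDegree

/-! ### Bounds and independence criterion in an arbitrary commutative algebra -/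

section Independence

variable {R : Type*} [CommRing R] [Algebra ℂ R] {J : Type*} [Fintype J] {ε : J → ℤ} {y : J → R}
  {a p : ℕ} {c : ℂ}

theorem card_add_le_of_algebraicIndependent (ha : a ≠ 0) (hc : c ≠ 0)
    (h0 : ∀ i < p, ∑ j, (ε j : R) * y j ^ (2 * i + a) = 0)
    (h1 : ∑ j, (ε j : R) * y j ^ (2 * p + a) = algebraMap ℂ R c)
    {ι : Type*} [Fintype ι] {f : ι → R} (hf : AlgebraicIndependent ℂ f)
    (hfy : ∀ i, f i ∈ Algebra.adjoin ℂ (Set.range y)) :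
    Fintype.card ι + (p + 1) ≤ Fintype.card J := by
  classical
  obtain ⟨P, hP, φ, hφ⟩ := exists_algHom_field_algebraicIndependent hf
  obtain ⟨S, hS, hcl, -⟩ := exists_subset_closure_of_sum_pow (k := ℂ) (ε := ε) (y := φ ∘ y)
    ha hc (fun i hi => by simpa using congrArg φ (h0 i hi)) (by simpa using congrArg φ h1)
  have h := card_le_of_algebraicIndependent (S := S.image (φ ∘ y)) hφ fun i => ?_
  · have := Finset.card_image_le (s := S) (f := φ ∘ y)
    omega
  · rw [Finset.coe_image]
    refine matroid_closure_trans (Y := Set.range (φ ∘ y)) (adjoin_subset_matroid_closure ?_) ?_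
    · rw [Set.range_comp, ← AlgHom.map_adjoin]
      exact ⟨f i, hfy i, rfl⟩
    · rintro _ ⟨j, rfl⟩
      exact hcl j

/-- All nodes become algebraic over the field generated by the specialized `z`, so that field has
transcendence degree at least `|J| - (p + 1)`, and `z` has no more members than that. -/
theorem algebraicIndependent_of_sum_pow_mem_adjoin (ha : a ≠ 0) (hc : c ≠ 0) (hε : ∀ j, ε j ≠ 0)
    (h0 : ∀ i < p, ∑ j, (ε j : R) * y j ^ (2 * i + a) = 0)
    (h1 : ∑ j, (ε j : R) * y j ^ (2 * p + a) = algebraMap ℂ R c)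
    {T : Finset J} (hT : T.card = p + 1)
    (hind : AlgebraicIndependent ℂ fun j : {j // j ∉ T} => y j) (j₀ : J)
    {κ : Type*} [Fintype κ] {z : κ → R} (hκ : Fintype.card κ + (p + 1) ≤ Fintype.card J)
    (hj₀ : y j₀ ∈ Algebra.adjoin ℂ (Set.range z))
    (hz : ∀ i < Fintype.card J - 1,
      ∑ j, (ε j : R) * y j ^ (2 * i + a) ∈ Algebra.adjoin ℂ (Set.range z)) :
    AlgebraicIndependent ℂ z := by
  classical
  obtain ⟨P, hP, φ, hφ⟩ := exists_algHom_field_algebraicIndependent hind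
  obtain ⟨S, hS, hcl, hSeq⟩ := exists_subset_closure_of_sum_pow (k := ℂ) (ε := ε) (y := φ ∘ y)
    ha hc (fun i hi => by simpa using congrArg φ (h0 i hi)) (by simpa using congrArg φ h1)
  have hcardT : Fintype.card {j // j ∉ T} + (p + 1) = Fintype.card J := by
    rw [Fintype.card_subtype_compl, Fintype.card_coe, hT]
    have := T.card_le_univ
    omega
  have hle := card_le_of_algebraicIndependent (S := S.image (φ ∘ y)) hφ fun i => by
    rw [Finset.coe_image]
    exact hcl i
  have hle2 := Finset.card_image_le (s := S) (f := φ ∘ y)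
  -- Independence of the nodes outside `T` forces the equality case of the dimension bound, so the
  -- specialized nodes have distinct nonzero squares.
  obtain ⟨hinj, hne⟩ := hSeq (by omega)
  let E := IntermediateField.adjoin ℂ (Set.range (φ ∘ z))
  have hE : ∀ x ∈ Algebra.adjoin ℂ (Set.range z), φ x ∈ E := by
    intro x hx
    refine IntermediateField.algebra_adjoin_le_adjoin ℂ _ ?_
    rw [Set.range_comp, ← AlgHom.map_adjoin]
    exact ⟨x, hx, rfl⟩
  have : CharZero E := charZero_of_injective_algebraMap (algebraMap ℂ E).injective
  -- The node `j₀` is already known, so the `|J| - 1` available power sums match the number of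
  -- remaining unknowns.
  have halg : ∀ j ∈ Finset.univ.erase j₀, IsAlgebraic E (φ (y j)) := by
    refine isAlgebraic_of_sum_pow_mem (c := fun j => (ε j : E)) ha hinj.injOn
      (fun j _ => hne j) (fun j _ => Int.cast_ne_zero.2 (hε j)) fun i hi => ?_
    rw [Finset.card_erase_of_mem (Finset.mem_univ _), Finset.card_univ] at hi
    have h2 : ∑ j, (ε j : FractionRing (R ⧸ P)) * φ (y j) ^ (2 * i + a) ∈ E := by
      simpa using hE _ (hz i hi)
    rw [← Finset.sum_erase_add _ _ (Finset.mem_univ j₀)] at h2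
    have h3 := (add_mem_cancel_right
      (mul_mem (intCast_mem E (ε j₀)) (pow_mem (hE _ hj₀) (2 * i + a)))).1 h2
    refine ⟨⟨_, h3⟩, ?_⟩
    simp [IntermediateField.algebraMap_apply]
  have hind' : AlgebraicIndependent ℂ (φ ∘ z) := by
    refine algebraicIndependent_of_mem_closure hφ (by omega) fun i => ?_
    rw [mem_matroid_closure_iff]
    by_cases hi : (i : J) = j₀
    · change IsAlgebraic E (φ (y i))
      rw [hi]
      exact isAlgebraic_algebraMap (⟨_, hE _ hj₀⟩ : E)
    · exact halg i (Finset.mem_erase.2 ⟨hi, Finset.mem_univ _⟩)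
  exact hind'.of_comp φ

end Independence

end

noncomputable section

/-! ### Deforming a point of the level set by the inverse function theorem -/

section Deformation

/-- Near a point with enough distinct squares the level set of the signed power sums projects onto
an open set of the remaining coordinates. -/
theorem exists_infinite_forall_exists_sum_pow_eq {J : Type*} [Fintype J] {ε : J → ℤ}
    (hε : ∀ j, ε j ≠ 0) {a p : ℕ} (ha : a ≠ 0) (y₀ : J → ℂ) {T : Finset J} (hT : T.card = p + 1)
    (hinj : Set.InjOn (fun j => y₀ j ^ 2) T) (hy₀ : ∀ j ∈ T, y₀ j ≠ 0) :
    ∃ U : J → Set ℂ, (∀ j, (U j).Infinite) ∧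
      ∀ v : J → ℂ, (∀ j, v j ∈ U j) → ∃ y : J → ℂ, (∀ j ∉ T, y j = v j) ∧
        ∀ i ≤ p, ∑ j, (ε j : ℂ) * y j ^ (2 * i + a) = ∑ j, (ε j : ℂ) * y₀ j ^ (2 * i + a) := by
  classical
  let e : T ≃ Fin (p + 1) := T.equivFinOfCardEq hT
  -- `Ψ` replaces the coordinates in `T` by the `p + 1` power sums. Its derivative at `y₀` is
  -- injective by Vandermonde, so its image contains a ball around `Ψ y₀`; in the sup metric that
  -- ball is a box.
  let Ψ : (J → ℂ) → (J → ℂ) := fun y j =>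
    if h : j ∈ T then ∑ l, (ε l : ℂ) * y l ^ (2 * (e ⟨j, h⟩ : ℕ) + a) else y j
  let Ψ' : (J → ℂ) →L[ℂ] (J → ℂ) := ContinuousLinearMap.pi fun j =>
    if h : j ∈ T then ∑ l, (ε l : ℂ) • (((2 * (e ⟨j, h⟩ : ℕ) + a : ℕ) : ℂ) *
      y₀ l ^ (2 * (e ⟨j, h⟩ : ℕ) + a - 1)) • ContinuousLinearMap.proj l
    else ContinuousLinearMap.proj j
  have hderiv : HasStrictFDerivAt Ψ Ψ' y₀ := by
    rw [hasStrictFDerivAt_pi']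
    intro j
    by_cases h : j ∈ T
    · simp only [Ψ, Ψ', dif_pos h, ContinuousLinearMap.proj_pi]
      refine HasStrictFDerivAt.fun_sum fun l _ => ?_
      have h1 : HasStrictFDerivAt (fun y : J → ℂ => y l)
          (ContinuousLinearMap.proj l : (J → ℂ) →L[ℂ] ℂ) y₀ :=
        (ContinuousLinearMap.proj l : (J → ℂ) →L[ℂ] ℂ).hasStrictFDerivAt
      have h2 := (h1.pow (2 * (e ⟨j, h⟩ : ℕ) + a)).const_mul (ε l : ℂ)
      rw [nsmul_eq_mul] at h2
      exact h2
    · simp only [Ψ, Ψ', dif_neg h, ContinuousLinearMap.proj_pi]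
      exact (ContinuousLinearMap.proj j : (J → ℂ) →L[ℂ] ℂ).hasStrictFDerivAt
  have hker : Function.Injective (Ψ' : (J → ℂ) →ₗ[ℂ] (J → ℂ)) := by
    rw [injective_iff_map_eq_zero]
    intro v hv
    have hoff : ∀ j ∉ T, v j = 0 := by
      intro j hj
      have := congrFun hv j
      simpa [Ψ', hj] using this
    have key := eq_zero_of_forall_sum_pow_smul_eq_zero (K := ℂ) hinj
      (v := fun l => (ε l : ℂ) * y₀ l ^ (a - 1) * v l) ?_
    · funext j
      by_cases hj : j ∈ T
      · exact (mul_eq_zero.1 (key j hj)).resolve_left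
          (mul_ne_zero (Int.cast_ne_zero.2 (hε j)) (pow_ne_zero _ (hy₀ j hj)))
      · exact hoff j hj
    · intro i hi
      rw [hT] at hi
      obtain ⟨⟨j, hj⟩, hji⟩ := e.surjective ⟨i, hi⟩
      have h1 := congrFun hv j
      simp only [Ψ', ContinuousLinearMap.coe_coe, ContinuousLinearMap.pi_apply, dif_pos hj, hji,
        _root_.sum_apply, _root_.smul_apply,
        ContinuousLinearMap.proj_apply, smul_eq_mul, Pi.zero_apply] at h1
      have hne : ((2 * i + a : ℕ) : ℂ) ≠ 0 := by
        rw [Nat.cast_ne_zero]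
        omega
      have h2 : ((2 * i + a : ℕ) : ℂ) *
          ∑ l ∈ T, (y₀ l ^ 2) ^ i • ((ε l : ℂ) * y₀ l ^ (a - 1) * v l) = 0 := by
        rw [← h1, Finset.mul_sum]
        rw [← Finset.sum_subset (Finset.subset_univ T)]
        · refine Finset.sum_congr rfl fun l _ => ?_
          rw [show 2 * i + a - 1 = 2 * i + (a - 1) by omega, pow_add, pow_mul, smul_eq_mul]
          ring
        · intro l _ hl
          rw [hoff l hl]
          ring
      exact (mul_eq_zero.1 h2).resolve_left hne
  have hrange : Ψ'.range = ⊤ :=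
    LinearMap.range_eq_top.2 (LinearMap.injective_iff_surjective.1 hker)
  have hnhds := hderiv.map_nhds_eq_of_surj hrange
  have hmem : Set.range Ψ ∈ nhds (Ψ y₀) := by
    rw [← hnhds, ← Set.image_univ]
    exact Filter.image_mem_map Filter.univ_mem
  obtain ⟨r, hr, hball⟩ := Metric.mem_nhds_iff.1 hmem
  refine ⟨fun j => Metric.ball (y₀ j) r, fun j => ?_, fun v hv => ?_⟩
  · exact infinite_of_mem_nhds (y₀ j) (Metric.ball_mem_nhds _ hr)
  · obtain ⟨y, hy⟩ := hball (show (fun j => if j ∈ T then Ψ y₀ j else v j) ∈ _ by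
      rw [Metric.mem_ball, dist_pi_lt_iff hr]
      intro j
      by_cases hj : j ∈ T
      · simpa [hj] using hr
      · have : Ψ y₀ j = y₀ j := by simp [Ψ, hj]
        rw [if_neg hj, this]
        exact hv j)
    refine ⟨y, fun j hj => ?_, fun i hi => ?_⟩
    · have := congrFun hy j
      simpa [Ψ, hj] using this
    · obtain ⟨⟨j, hj⟩, hji⟩ := e.surjective ⟨i, Nat.lt_succ_of_le hi⟩
      have := congrFun hy j
      simpa [Ψ, hj, hji] using this

/-- Functions whose joint values contain a box with infinite sides are algebraically
independent. -/
theorem algebraicIndependent_of_forall_exists_eq {k V J : Type*} [Field k] {y : J → V → k}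
    {U : J → Set k} (hU : ∀ j, (U j).Infinite)
    (h : ∀ v : J → k, (∀ j, v j ∈ U j) → ∃ w, ∀ j, y j w = v j) :
    AlgebraicIndependent k y := by
  rw [algebraicIndependent_iff]
  intro f hf
  refine MvPolynomial.funext_set U hU fun v hv => ?_
  obtain ⟨w, hw⟩ := h v fun j => hv j (Set.mem_univ j)
  have h1 := congrFun hf w
  rw [map_zero, ← show (fun j => y j w) = v from funext hw]
  have h3 : MvPolynomial.aeval (fun j => y j w) f = (MvPolynomial.aeval y f) w := by
    have : MvPolynomial.aeval (fun j => y j w) =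
        (Pi.evalAlgHom k (fun _ : V => k) w).comp (MvPolynomial.aeval y) := by
      ext
      simp
    rw [this]
    rfl
  rw [← MvPolynomial.coe_aeval_eq_eval]
  exact h3.trans h1

end Deformation

end

noncomputable section

/-! ### Exponential series and the order of the denominator -/

section ExpSeries

theorem expSeries_zero : expSeries 0 = 1 := by
  ext n
  rw [coeff_expSeries, coeff_one]
  rcases n with _ | n <;> simp

theorem expSeries_mul_neg (a : ℂ) : expSeries a * expSeries (-a) = 1 := by
  rw [← expSeries_add, add_neg_cancel, expSeries_zero]

theorem rescale_neg_one_expSeries (a : ℂ) : rescale (-1) (expSeries a) = expSeries (-a) := by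
  ext n
  rw [coeff_rescale, coeff_expSeries, coeff_expSeries, neg_pow a]
  ring

theorem exists_one_sub_expSeries_eq (a : ℂ) :
    ∃ V : ℂ⟦X⟧, constantCoeff V = -a ∧ 1 - expSeries a = X * V := by
  obtain ⟨V, hV⟩ : X ∣ 1 - expSeries a := by
    rw [X_dvd_iff, ← coeff_zero_eq_constantCoeff_apply, map_sub, coeff_expSeries]
    simp
  refine ⟨V, ?_, hV⟩
  have := congrArg (coeff 1) hV
  rw [map_sub, coeff_expSeries, coeff_one, show 1 = 0 + 1 from rfl, coeff_succ_X_mul,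
    coeff_zero_eq_constantCoeff_apply] at this
  simp at this
  exact this.symm

theorem exists_prod_one_sub_expSeries_eq {m : ℕ} (d : Fin m → ℕ) :
    ∃ W : ℂ⟦X⟧, constantCoeff W = (-1) ^ m * ∏ i, (d i : ℂ) ∧
      ∏ i, (1 - expSeries (d i)) = X ^ m * W := by
  choose V hV0 hV using exists_one_sub_expSeries_eq
  refine ⟨∏ i, V (d i), ?_, ?_⟩
  · rw [map_prod]
    simp only [hV0, Finset.prod_neg, Finset.card_univ, Fintype.card_fin]
  · simp only [hV, Finset.prod_mul_distrib, Finset.prod_const, Finset.card_univ,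
      Fintype.card_fin]

end ExpSeries

/-! ### Power sums of the centred degrees -/

section Centered

variable {m : ℕ} {d : Fin m → ℕ} {b : ℕ → ℕ}

/-- The sign of a syzygy in the alternating sums. -/
def syzygySign (i : Σ k : Fin m, Fin (b k)) : ℤ := (-1) ^ (i.1 : ℕ)

namespace SyzygySolution

/-- The degrees of syzygies, shifted so that the symmetry becomes `x ↦ -x`. -/
def centered (w : SyzygySolution d b) (i : Σ k : Fin m, Fin (b k)) : ℂ := w.C i.1 i.2 - w.Q / 2

/-- The exponential generating function of the genera. -/
def genusSeries (w : SyzygySolution d b) : ℂ⟦X⟧ :=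
  PowerSeries.mk fun r => w.G r / (r.factorial : ℂ)

end SyzygySolution

/-- The signed exponential sum of a family of numbers. -/
def signedExpSum (y : (Σ k : Fin m, Fin (b k)) → ℂ) : ℂ⟦X⟧ :=
  ∑ i, (syzygySign i : ℂ⟦X⟧) * expSeries (y i)

theorem coeff_signedExpSum (y : (Σ k : Fin m, Fin (b k)) → ℂ) (n : ℕ) :
    coeff n (signedExpSum y) = (∑ i, (syzygySign i : ℂ) * y i ^ n) / n.factorial := by
  rw [signedExpSum, map_sum, Finset.sum_div]
  refine Finset.sum_congr rfl fun i _ => ?_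
  have : (syzygySign i : ℂ⟦X⟧) = C (syzygySign i : ℂ) := by simp
  rw [this, coeff_C_mul, coeff_expSeries, mul_div_assoc]

theorem sum_sum_expSeries_eq (Q : ℂ) (y : (Σ k : Fin m, Fin (b k)) → ℂ) :
    ∑ k : Fin m, (-1) ^ (k : ℕ) * ∑ j : Fin (b k), expSeries (y ⟨k, j⟩ + Q / 2) =
      expSeries (Q / 2) * signedExpSum y := by
  rw [signedExpSum, Fintype.sum_sigma, Finset.mul_sum]
  refine Finset.sum_congr rfl fun k _ => ?_
  rw [Finset.mul_sum, Finset.mul_sum]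
  refine Finset.sum_congr rfl fun j _ => ?_
  rw [expSeries_add]
  simp only [syzygySign]
  push_cast
  ring

theorem SyzygySolution.hilbert_centered (w : SyzygySolution d b) :
    (1 - expSeries 1) * (expSeries (w.Q / 2) * signedExpSum w.centered) =
      (∏ i, (1 - expSeries (d i))) * (1 - (1 - expSeries 1) * w.genusSeries) := by
  rw [← sum_sum_expSeries_eq]
  simp only [SyzygySolution.centered, sub_add_cancel]
  exact w.hilbert

/-- The signed exponential sum has order `m - 1`, with universal coefficients apart from the genera
and the shift. -/
theorem exists_signedExpSum_eq (hm : 0 < m) :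
    ∃ U V : ℂ⟦X⟧, constantCoeff U = (-1) ^ (m - 1) * ∏ i, (d i : ℂ) ∧ constantCoeff V = -1 ∧
      ∀ w : SyzygySolution d b, signedExpSum w.centered =
        X ^ (m - 1) * (U * expSeries (-(w.Q / 2)) * (1 - X * (V * w.genusSeries))) := by
  obtain ⟨n, rfl⟩ : ∃ n, m = n + 1 := ⟨m - 1, by omega⟩
  obtain ⟨V, hV0, hV⟩ := exists_one_sub_expSeries_eq 1
  obtain ⟨W, hW0, hW⟩ := exists_prod_one_sub_expSeries_eq d
  have hVinv : V * V⁻¹ = 1 := PowerSeries.mul_inv_cancel _ (by simp [hV0])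
  refine ⟨W * V⁻¹, V, ?_, hV0, fun w => ?_⟩
  · rw [map_mul, PowerSeries.constantCoeff_inv, hV0, hW0, Nat.add_sub_cancel, pow_succ]
    norm_num
  · have h := w.hilbert_centered
    rw [hV, hW] at h
    have h1 : V * (expSeries (w.Q / 2) * signedExpSum w.centered) =
        X ^ n * W * (1 - X * (V * w.genusSeries)) := by
      apply mul_left_cancel₀ (X_ne_zero (R := ℂ))
      rw [← mul_assoc, h]
      ring
    have h2 := expSeries_mul_neg (w.Q / 2)
    rw [Nat.add_sub_cancel]
    linear_combination V⁻¹ * expSeries (-(w.Q / 2)) * h1 -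
      signedExpSum w.centered * hVinv - V * V⁻¹ * signedExpSum w.centered * h2

/-- The product over the generators has order `m` in `t` and `1 - z` has order `1`, so the signed
exponential sum starts at order `m - 1`. -/
theorem sum_pow_centered_eq_zero (w : SyzygySolution d b) {n : ℕ} (hn : n + 1 < m) :
    ∑ i, (syzygySign i : ℂ) * w.centered i ^ n = 0 := by
  obtain ⟨U, V, -, -, h⟩ := exists_signedExpSum_eq (d := d) (b := b) (by omega : 0 < m)
  have h1 := coeff_signedExpSum w.centered n
  rw [h w, coeff_X_pow_mul', if_neg (by omega), eq_comm, div_eq_zero_iff] at h1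
  exact h1.resolve_right (Nat.cast_ne_zero.2 n.factorial_ne_zero)

theorem sum_pow_centered_eq (w : SyzygySolution d b) {n : ℕ} (hn : n + 1 = m) :
    ∑ i, (syzygySign i : ℂ) * w.centered i ^ n =
      n.factorial * ((-1) ^ n * ∏ i, (d i : ℂ)) := by
  obtain ⟨U, V, hU, -, h⟩ := exists_signedExpSum_eq (d := d) (b := b) (by omega : 0 < m)
  have h1 := coeff_signedExpSum w.centered n
  have hn' : m - 1 = n := by omega
  rw [hn'] at h hU
  rw [h w, coeff_X_pow_mul', if_pos le_rfl, Nat.sub_self, coeff_zero_eq_constantCoeff_apply,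
    eq_div_iff (Nat.cast_ne_zero.2 n.factorial_ne_zero)] at h1
  rw [← h1, map_mul, map_mul, hU, map_sub, map_mul, constantCoeff_X,
    ← coeff_zero_eq_constantCoeff_apply, coeff_expSeries]
  simp
  ring

/-- A series of order `m - 1` with the right leading coefficient determines the genera. -/
theorem exists_genusSeries_of_coeff (hm : 0 < m) (hd : ∀ i, 0 < d i) (Q : ℂ) {E : ℂ⟦X⟧}
    (h0 : ∀ n, n + 1 < m → coeff n E = 0)
    (h1 : coeff (m - 1) E = (-1) ^ (m - 1) * ∏ i, (d i : ℂ)) :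
    ∃ Φ : ℂ⟦X⟧, (1 - expSeries 1) * (expSeries (Q / 2) * E) =
      (∏ i, (1 - expSeries (d i))) * (1 - (1 - expSeries 1) * Φ) := by
  obtain ⟨n, rfl⟩ : ∃ n, m = n + 1 := ⟨m - 1, by omega⟩
  rw [Nat.add_sub_cancel] at h1
  obtain ⟨V, hV0, hV⟩ := exists_one_sub_expSeries_eq 1
  obtain ⟨W, hW0, hW⟩ := exists_prod_one_sub_expSeries_eq d
  have hd0 : ∏ i, (d i : ℂ) ≠ 0 :=
    Finset.prod_ne_zero_iff.2 fun i _ => Nat.cast_ne_zero.2 (hd i).ne'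
  have hVinv : V * V⁻¹ = 1 := PowerSeries.mul_inv_cancel _ (by simp [hV0])
  have hWne : constantCoeff W ≠ 0 := by
    rw [hW0]
    exact mul_ne_zero (pow_ne_zero _ (neg_ne_zero.2 one_ne_zero)) hd0
  have hWinv : W * W⁻¹ = 1 := PowerSeries.mul_inv_cancel _ hWne
  obtain ⟨D, rfl⟩ : X ^ n ∣ E := X_pow_dvd_iff.2 fun k hk => h0 k (by omega)
  have hD : constantCoeff D = (-1) ^ n * ∏ i, (d i : ℂ) := by
    rw [← h1, coeff_X_pow_mul', if_pos le_rfl, Nat.sub_self, coeff_zero_eq_constantCoeff_apply]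
  -- The prescribed leading coefficient is exactly what cancels the constant term here, so that one
  -- can divide by `1 - z` to obtain the genera.
  obtain ⟨Z, hZ⟩ : X ∣ 1 - W⁻¹ * V * expSeries (Q / 2) * D := by
    rw [X_dvd_iff, map_sub, map_mul, map_mul, map_mul, PowerSeries.constantCoeff_inv, hD, hV0,
      ← coeff_zero_eq_constantCoeff_apply (expSeries (Q / 2)), coeff_expSeries, hW0, pow_succ]
    field_simp
    simp
  refine ⟨V⁻¹ * Z, ?_⟩
  rw [hV, hW]
  linear_combination (X ^ (n + 2) * W * Z) * hVinv - X ^ (n + 1) * W * hZ -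
    X ^ (n + 1) * V * expSeries (Q / 2) * D * hWinv

end Centered

end

noncomputable section

/-! ### The reflection of the syzygies and the functional equation of the genera -/

section Reflection

theorem expSeries_sum {ι : Type*} (s : Finset ι) (f : ι → ℂ) :
    expSeries (∑ i ∈ s, f i) = ∏ i ∈ s, expSeries (f i) := by
  classical
  induction s using Finset.induction_on with
  | empty => simp [expSeries_zero]
  | insert i s hi ih => rw [Finset.sum_insert hi, Finset.prod_insert hi, expSeries_add, ih]

variable {m : ℕ} {d : Fin m → ℕ} {b : ℕ → ℕ}

theorem syzygyIndex_ext {i i' : Σ k : Fin m, Fin (b k)} (h1 : (i.1 : ℕ) = i'.1)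
    (h2 : (i.2 : ℕ) = i'.2) : i = i' := by
  obtain ⟨k, j⟩ := i
  obtain ⟨k', j'⟩ := i'
  obtain rfl : k = k' := Fin.ext h1
  obtain rfl : j = j' := Fin.ext h2
  rfl

/-- The involution of the syzygies given by the symmetry of the semigroup. -/
def syzygyReflection (hb : ∀ k l, k + l + 1 = m → b k = b l) (i : Σ k : Fin m, Fin (b k)) :
    Σ k : Fin m, Fin (b k) :=
  ⟨i.1.rev, Fin.cast (hb _ _ (by rw [Fin.val_rev]; omega)) i.2.rev⟩

variable (hb : ∀ k l, k + l + 1 = m → b k = b l)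

theorem syzygyReflection_fst (i : Σ k : Fin m, Fin (b k)) :
    ((syzygyReflection hb i).1 : ℕ) = m - (i.1 + 1) := Fin.val_rev _

theorem syzygyReflection_snd (i : Σ k : Fin m, Fin (b k)) :
    ((syzygyReflection hb i).2 : ℕ) = b i.1 - (i.2 + 1) := Fin.val_rev _

theorem apply_syzygyReflection_fst (i : Σ k : Fin m, Fin (b k)) :
    b (syzygyReflection hb i).1 = b i.1 := by
  refine hb _ _ ?_
  have := syzygyReflection_fst hb i
  have := i.1.isLt
  omega

theorem syzygyReflection_involutive : Function.Involutive (syzygyReflection hb) := by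
  intro i
  have h1 := syzygyReflection_fst hb i
  have h2 := syzygyReflection_snd hb i
  have h3 := syzygyReflection_fst hb (syzygyReflection hb i)
  have h4 := syzygyReflection_snd hb (syzygyReflection hb i)
  have h5 := apply_syzygyReflection_fst hb i
  have h6 := i.1.isLt
  have h7 := i.2.isLt
  exact syzygyIndex_ext (by omega) (by omega)

theorem syzygySign_syzygyReflection (i : Σ k : Fin m, Fin (b k)) :
    syzygySign (syzygyReflection hb i) = (-1) ^ (m - 1) * syzygySign i := by
  have h1 := syzygyReflection_fst hb i
  have h6 := i.1.isLt
  have h2 : (-1 : ℤ) ^ (i.1 : ℕ) * (-1) ^ (i.1 : ℕ) = 1 := by rw [← mul_pow]; simp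
  have h3 : m - 1 = ((syzygyReflection hb i).1 : ℕ) + i.1 := by omega
  rw [syzygySign, syzygySign, h3, pow_add, mul_assoc, h2, mul_one]

theorem SyzygySolution.centered_syzygyReflection (w : SyzygySolution d b)
    (i : Σ k : Fin m, Fin (b k)) : w.centered (syzygyReflection hb i) = -w.centered i := by
  have h1 := syzygyReflection_fst hb i
  have h2 := syzygyReflection_snd hb i
  have h6 := i.1.isLt
  have h7 := i.2.isLt
  have := w.symm i.1 (syzygyReflection hb i).1 i.2 (syzygyReflection hb i).2 (by omega) (by omega)
  simp only [SyzygySolution.centered]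
  linear_combination this

/-- The signed sum over all the syzygies of an odd or even family. -/
theorem rescale_neg_one_signedExpSum {y : (Σ k : Fin m, Fin (b k)) → ℂ}
    (hy : ∀ i, y (syzygyReflection hb i) = -y i) :
    rescale (-1) (signedExpSum y) = (-1) ^ (m - 1) * signedExpSum y := by
  rw [signedExpSum, map_sum, Finset.mul_sum,
    ← Equiv.sum_comp (syzygyReflection_involutive hb).toPerm]
  refine Finset.sum_congr rfl fun i _ => ?_
  rw [map_mul, rescale_neg_one_expSeries, map_intCast, Function.Involutive.coe_toPerm, hy,
    neg_neg, syzygySign_syzygyReflection]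
  push_cast
  ring

/-- Replace `t` by `-t` in the centred Hilbert identity: the exponential sum changes only by
`(-1)^(m-1)`, and each `1 - z^a` by the factor `-z^(-a)`. Cancelling the product leaves `Φ(z) + z^F
Φ(1/z) = (1 - z^(F+1)) / (1 - z)` with `F = Q - ∑ d`, the series form of the symmetry `n ↦ F - n`.
-/
theorem SyzygySolution.genusSeries_functional_equation (hm : 0 < m) (hd : ∀ i, 0 < d i)
    (hb : ∀ k l, k + l + 1 = m → b k = b l) (w : SyzygySolution d b) :
    (1 - expSeries 1) * (w.genusSeries +
      expSeries (w.Q - ∑ i, (d i : ℂ)) * rescale (-1) w.genusSeries) =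
      1 - expSeries (w.Q - ∑ i, (d i : ℂ)) * expSeries 1 := by
  have hneg : ∀ a : ℂ, rescale (-1) (1 - expSeries a) = -expSeries (-a) * (1 - expSeries a) := by
    intro a
    rw [map_sub, map_one, rescale_neg_one_expSeries]
    linear_combination -expSeries_mul_neg a
  have h1 := w.hilbert_centered
  have h2 := congrArg (rescale (-1 : ℂ)) h1
  have hprod : ∏ i, (rescale (-1 : ℂ)) (1 - expSeries (d i)) =
      (-1) ^ m * expSeries (-∑ i, (d i : ℂ)) * ∏ i, (1 - expSeries (d i)) := by
    have he : expSeries (-∑ i, (d i : ℂ)) = ∏ i, expSeries (-(d i : ℂ)) := by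
      rw [← Finset.sum_neg_distrib, expSeries_sum]
    simp only [hneg, Finset.prod_mul_distrib, Finset.prod_neg, Finset.card_univ,
      Fintype.card_fin, he]
  rw [map_mul, map_mul, map_mul, hneg, rescale_neg_one_expSeries,
    rescale_neg_one_signedExpSum hb (w.centered_syzygyReflection hb), map_prod, hprod, map_sub,
    map_mul, hneg, map_one] at h2
  have hP : ∏ i, (1 - expSeries (d i)) ≠ 0 := by
    refine Finset.prod_ne_zero_iff.2 fun i _ h => ?_
    have := congrArg (coeff 1) h
    rw [map_sub, coeff_one, coeff_expSeries] at this
    simp [(hd i).ne'] at this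
  obtain ⟨n, rfl⟩ : ∃ n, m = n + 1 := ⟨m - 1, by omega⟩
  have hs : ((-1 : ℂ⟦X⟧) ^ n) * (-1) ^ n = 1 := by rw [← mul_pow]; simp
  have hQ : expSeries (w.Q - ∑ i, (d i : ℂ)) =
      expSeries (w.Q / 2) * expSeries (w.Q / 2) * expSeries (-∑ i, (d i : ℂ)) := by
    rw [← expSeries_add, ← expSeries_add]
    congr 1
    ring
  have hu := expSeries_mul_neg (w.Q / 2)
  have ht := expSeries_mul_neg 1
  rw [Nat.add_sub_cancel, pow_succ] at h2
  have h3 : expSeries (-1) * (1 - expSeries 1) * (expSeries (-(w.Q / 2)) *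
      signedExpSum w.centered) = expSeries (-∑ i, (d i : ℂ)) * (∏ i, (1 - expSeries (d i))) *
        (1 + expSeries (-1) * (1 - expSeries 1) * rescale (-1) w.genusSeries) := by
    linear_combination -(-1) ^ n * h2 - (expSeries (-1) * (1 - expSeries 1) *
      (expSeries (-(w.Q / 2)) * signedExpSum w.centered) - expSeries (-∑ i, (d i : ℂ)) *
      (∏ i, (1 - expSeries (d i))) *
        (1 + expSeries (-1) * (1 - expSeries 1) * rescale (-1) w.genusSeries)) * hs
  have h4 : (1 - expSeries 1) * (expSeries (w.Q / 2) * signedExpSum w.centered) =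
      expSeries (w.Q - ∑ i, (d i : ℂ)) * (∏ i, (1 - expSeries (d i))) *
        (expSeries 1 + (1 - expSeries 1) * rescale (-1) w.genusSeries) := by
    rw [hQ]
    linear_combination expSeries (w.Q / 2) * expSeries (w.Q / 2) * expSeries 1 * h3 -
      (1 - expSeries 1) * expSeries (w.Q / 2) * signedExpSum w.centered *
        (expSeries 1 * expSeries (-1)) * hu -
      ((1 - expSeries 1) * expSeries (w.Q / 2) * signedExpSum w.centered -
        expSeries (w.Q / 2) * expSeries (w.Q / 2) * expSeries (-∑ i, (d i : ℂ)) *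
        (∏ i, (1 - expSeries (d i))) * (1 - expSeries 1) * rescale (-1) w.genusSeries) * ht
  apply mul_left_cancel₀ hP
  linear_combination h1 - h4

end Reflection

end

noncomputable section

/-! ### Bernoulli relations for the genera of even index -/

section EvenGenera

variable {m : ℕ} {d : Fin m → ℕ} {b : ℕ → ℕ}

/-- The right side of the functional equation is `z^F + (z^F - 1) / (z - 1)`, and `t / (z - 1)`
generates the Bernoulli numbers with `B_1 = -1/2`. -/
theorem SyzygySolution.bernoulli_equation (hm : 0 < m) (hd : ∀ i, 0 < d i)
    (hb : ∀ k l, k + l + 1 = m → b k = b l) (w : SyzygySolution d b) :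
    X * (w.genusSeries + expSeries (w.Q - ∑ i, (d i : ℂ)) * rescale (-1) w.genusSeries) =
      bernoulliPowerSeries ℂ * (expSeries (w.Q - ∑ i, (d i : ℂ)) - 1) +
        X * expSeries (w.Q - ∑ i, (d i : ℂ)) := by
  have h := w.genusSeries_functional_equation hm hd hb
  have hB := bernoulliPowerSeries_mul_exp_sub_one ℂ
  have h1 : expSeries 1 = exp ℂ := by simp [expSeries, rescale_one]
  rw [h1] at h
  linear_combination -bernoulliPowerSeries ℂ * h - (w.genusSeries +
    expSeries (w.Q - ∑ i, (d i : ℂ)) * rescale (-1) w.genusSeries -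
    expSeries (w.Q - ∑ i, (d i : ℂ))) * hB

theorem SyzygySolution.coeff_bernoulli_equation (hm : 0 < m) (hd : ∀ i, 0 < d i)
    (hb : ∀ k l, k + l + 1 = m → b k = b l) (w : SyzygySolution d b) (n : ℕ) :
    w.G n / n.factorial + ∑ i ∈ range (n + 1), (w.Q - ∑ i, (d i : ℂ)) ^ i / i.factorial *
      ((-1) ^ (n - i) * (w.G (n - i) / (n - i).factorial)) =
    ∑ i ∈ range (n + 1), (w.Q - ∑ i, (d i : ℂ)) ^ (i + 1) / (i + 1).factorial *
      (((bernoulli (n - i) : ℚ) : ℂ) / (n - i).factorial) +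
        (w.Q - ∑ i, (d i : ℂ)) ^ n / n.factorial := by
  have h := congrArg (coeff (n + 1)) (w.bernoulli_equation hm hd hb)
  rw [coeff_succ_X_mul, map_add, map_add, coeff_succ_X_mul, coeff_expSeries, coeff_mul,
    Finset.Nat.sum_antidiagonal_eq_sum_range_succ_mk, mul_comm (bernoulliPowerSeries ℂ), coeff_mul,
    Finset.Nat.sum_antidiagonal_eq_sum_range_succ_mk, Finset.sum_range_succ' _ (n + 1)] at h
  simp only [coeff_expSeries, coeff_rescale, SyzygySolution.genusSeries, coeff_mk, map_sub,
    coeff_one, bernoulliPowerSeries, Nat.add_sub_add_right] at h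
  simpa using h

theorem SyzygySolution.two_mul_G_zero (hm : 0 < m) (hd : ∀ i, 0 < d i)
    (hb : ∀ k l, k + l + 1 = m → b k = b l) (w : SyzygySolution d b) :
    2 * w.G 0 = w.Q - ∑ i, (d i : ℂ) + 1 := by
  have h := w.coeff_bernoulli_equation hm hd hb 0
  simp at h
  linear_combination h

/-- The relations that express the genera of even order through those of smaller order. -/
theorem SyzygySolution.G_even (hm : 0 < m) (hd : ∀ i, 0 < d i)
    (hb : ∀ k l, k + l + 1 = m → b k = b l) (w : SyzygySolution d b) (r : ℕ) (hr : 1 ≤ r) :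
    w.G (2 * r) = (2 * w.G 0 - 1) *
      (1 / 2 * ∑ p ∈ Finset.range (2 * r - 1),
          (((2 * r).choose p : ℂ) * ((bernoulli (2 * r - p) : ℚ) : ℂ) / ((p : ℂ) + 1) +
            (-1) ^ p * ((2 * r).choose (p + 1) : ℂ) * w.G (2 * r - p - 1)) *
            (2 * w.G 0 - 1) ^ p -
        (2 * (r : ℂ) - 1) / (2 * (r : ℂ) + 1) * ((2 * w.G 0 - 1) ^ (2 * r) / 4)) := by
  have h := w.coeff_bernoulli_equation hm hd hb (2 * r)
  have h0 := w.two_mul_G_zero hm hd hb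
  rw [show w.Q - ∑ i, (d i : ℂ) = 2 * w.G 0 - 1 by linear_combination -h0] at h
  clear h0
  set F := 2 * w.G 0 - 1 with hF
  have hG0 : w.G 0 = (F + 1) / 2 := by rw [hF]; ring
  obtain ⟨N, hN⟩ : ∃ N, 2 * r = N + 1 := ⟨2 * r - 1, by omega⟩
  have hNr : (N : ℂ) = 2 * r - 1 := by
    have : ((2 * r : ℕ) : ℂ) = ((N + 1 : ℕ) : ℂ) := by rw [hN]
    push_cast at this
    linear_combination -this
  have hodd : (-1 : ℂ) ^ N = -1 := Odd.neg_one_pow ⟨r - 1, by omega⟩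
  rw [hN] at h ⊢
  have hfac : ((N + 1).factorial : ℂ) ≠ 0 := Nat.cast_ne_zero.2 (Nat.factorial_ne_zero _)
  -- The end terms are split off: on the left `i = 2 r` gives `G 0` and `i = 0` a second copy of `G
  -- (2 r)`; on the right the terms with `B_0` and `B_1` are pure powers of `F`.
  rw [Finset.sum_range_succ, Finset.sum_range_succ', Finset.sum_range_succ,
    Finset.sum_range_succ _ N] at h
  have hterm : ∀ p ∈ range N, F ^ (p + 1) / (p + 1).factorial *
      ((-1) ^ (N + 1 - (p + 1)) * (w.G (N + 1 - (p + 1)) / (N + 1 - (p + 1)).factorial)) =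
      -(((-1) ^ p * ((N + 1).choose (p + 1) : ℂ) * w.G (N + 1 - p - 1)) * F ^ p) * F /
        (N + 1).factorial := by
    intro p hp
    have hp' := Finset.mem_range.1 hp
    rw [Nat.cast_choose ℂ (by omega : p + 1 ≤ N + 1)]
    have e1 : (-1 : ℂ) ^ (N + 1 - (p + 1)) = -(-1) ^ p := by
      have : N = (N - p) + p := by omega
      rw [this, pow_add] at hodd
      have h2 : (-1 : ℂ) ^ p * (-1) ^ p = 1 := by rw [← mul_pow]; simp
      rw [Nat.add_sub_add_right]
      linear_combination (-1) ^ p * hodd - (-1) ^ (N - p) * h2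
    have h3 : ((p + 1).factorial : ℂ) ≠ 0 := Nat.cast_ne_zero.2 (Nat.factorial_ne_zero _)
    have h4 : ((N + 1 - (p + 1)).factorial : ℂ) ≠ 0 := Nat.cast_ne_zero.2 (Nat.factorial_ne_zero _)
    rw [e1, Nat.sub_sub]
    field_simp
    ring
  have hterm2 : ∀ p ∈ range N, F ^ (p + 1) / (p + 1).factorial *
      (((bernoulli (N + 1 - p) : ℚ) : ℂ) / (N + 1 - p).factorial) =
      ((N + 1).choose p : ℂ) * ((bernoulli (N + 1 - p) : ℚ) : ℂ) / ((p : ℂ) + 1) * F ^ p * F /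
        (N + 1).factorial := by
    intro p hp
    have hp' := Finset.mem_range.1 hp
    rw [Nat.cast_choose ℂ (by omega : p ≤ N + 1)]
    have h3 : (p.factorial : ℂ) ≠ 0 := Nat.cast_ne_zero.2 (Nat.factorial_ne_zero _)
    have h4 : ((N + 1 - p).factorial : ℂ) ≠ 0 := Nat.cast_ne_zero.2 (Nat.factorial_ne_zero _)
    have h5 : (p : ℂ) + 1 ≠ 0 := Nat.cast_add_one_ne_zero p
    rw [Nat.factorial_succ]
    push_cast
    field_simp
    ring
  rw [Finset.sum_congr rfl hterm, Finset.sum_congr rfl hterm2, ← Finset.sum_div, ← Finset.sum_div,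
    ← Finset.sum_mul, ← Finset.sum_mul, Finset.sum_neg_distrib] at h
  have hb1 : ((bernoulli 1 : ℚ) : ℂ) = -1 / 2 := by
    rw [bernoulli_one]
    norm_num
  have heven : (-1 : ℂ) ^ (N + 1) = 1 := by rw [pow_succ, hodd]; norm_num
  simp only [Nat.sub_self, Nat.sub_zero, heven, hb1, bernoulli_zero, Nat.factorial_zero,
    Nat.add_sub_cancel_left, Nat.factorial_one, Nat.cast_one, Rat.cast_one, pow_zero, hG0] at h
  rw [Nat.factorial_succ (N + 1)] at h
  push_cast at h ⊢
  simp only [add_mul _ _ (F ^ _), Finset.sum_add_distrib]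
  have hN2 : (N : ℂ) + 1 + 1 ≠ 0 := by exact_mod_cast Nat.succ_ne_zero (N + 1)
  have hr2 : (2 : ℂ) * r + 1 = N + 1 + 1 := by rw [hNr]; ring
  have hr3 : (2 : ℂ) * r - 1 = N := by rw [hNr]
  rw [hr2, hr3]
  set S1 := ∑ p ∈ range N, ((N + 1).choose p : ℂ) * ((bernoulli (N + 1 - p) : ℚ) : ℂ) /
    ((p : ℂ) + 1) * F ^ p
  set S2 := ∑ p ∈ range N, (-1) ^ p * ((N + 1).choose (p + 1) : ℂ) * w.G (N + 1 - p - 1) * F ^ p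
  clear_value S1 S2 F
  field_simp at h ⊢
  linear_combination 2 * h

end EvenGenera

end

noncomputable section

/-! ### Coefficients of power series as functions on the variety -/

section CoefficientFunctions

variable {W : Type*}

/-- The coefficients up to order `N` of a family of power series belong to an algebra of
functions. -/
def CoeffsMem (A : Subalgebra ℂ (W → ℂ)) (N : ℕ) (S : W → ℂ⟦X⟧) : Prop :=
  ∀ n ≤ N, (fun w => coeff n (S w)) ∈ A

variable {A : Subalgebra ℂ (W → ℂ)} {N : ℕ} {S T : W → ℂ⟦X⟧}

theorem CoeffsMem.const (s : ℂ⟦X⟧) : CoeffsMem A N fun _ => s :=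
  fun n _ => A.algebraMap_mem (coeff n s)

theorem CoeffsMem.sub (hS : CoeffsMem A N S) (hT : CoeffsMem A N T) :
    CoeffsMem A N fun w => S w - T w := by
  intro n hn
  simp only [map_sub]
  exact sub_mem (hS n hn) (hT n hn)

theorem CoeffsMem.mul (hS : CoeffsMem A N S) (hT : CoeffsMem A N T) :
    CoeffsMem A N fun w => S w * T w := by
  intro n hn
  have h : (fun w => coeff n (S w * T w)) =
      ∑ p ∈ Finset.HasAntidiagonal.antidiagonal n, (fun w => coeff p.1 (S w)) * fun w => coeff p.2 (T w) := by
    funext w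
    simp [coeff_mul, Finset.sum_apply]
  rw [h]
  refine sum_mem fun p hp => ?_
  have := Finset.HasAntidiagonal.mem_antidiagonal.1 hp
  exact mul_mem (hS _ (by omega)) (hT _ (by omega))

theorem CoeffsMem.expSeries {f : W → ℂ} (hf : f ∈ A) : CoeffsMem A N fun w => expSeries (f w) := by
  intro n _
  have h : (fun w => coeff n (_root_.expSeries (f w))) = ((n.factorial : ℂ)⁻¹) • f ^ n := by
    funext w
    simp only [coeff_expSeries, Pi.smul_apply, Pi.pow_apply, smul_eq_mul]
    ring
  rw [h]
  exact A.smul_mem (pow_mem hf n) _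

theorem CoeffsMem.X_mul (hS : ∀ n < N, (fun w => coeff n (S w)) ∈ A) :
    CoeffsMem A N fun w => X * S w := by
  intro n hn
  rcases n with _ | n
  · simp only [coeff_zero_X_mul]
    exact zero_mem A
  · simp only [coeff_succ_X_mul]
    exact hS n (by omega)

end CoefficientFunctions

/-! ### Passing between genera and power sums by polynomial formulas -/

section GenusAlgebra

variable {m : ℕ} {d : Fin m → ℕ} {b : ℕ → ℕ}

theorem coeff_genusSeries (w : SyzygySolution d b) (n : ℕ) :
    coeff n w.genusSeries = w.G n / n.factorial := coeff_mk _ _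

theorem coeff_genusSeries_mem_iff {A : Subalgebra ℂ (SyzygySolution d b → ℂ)} (n : ℕ) :
    (fun w : SyzygySolution d b => coeff n w.genusSeries) ∈ A ↔ genusFunction d b n ∈ A := by
  have h : genusFunction d b n =
      (n.factorial : ℂ) • fun w : SyzygySolution d b => coeff n w.genusSeries := by
    funext w
    have : (n.factorial : ℂ) ≠ 0 := Nat.cast_ne_zero.2 (Nat.factorial_ne_zero n)
    simp only [genusFunction, coeff_genusSeries, Pi.smul_apply, smul_eq_mul]
    field_simp
  have h' : (fun w : SyzygySolution d b => coeff n w.genusSeries) =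
      ((n.factorial : ℂ)⁻¹) • genusFunction d b n := by
    have : (n.factorial : ℂ) ≠ 0 := Nat.cast_ne_zero.2 (Nat.factorial_ne_zero n)
    rw [h, smul_smul, inv_mul_cancel₀ this, one_smul]
  constructor
  · intro hm
    rw [h]
    exact A.smul_mem hm _
  · intro hm
    rw [h']
    exact A.smul_mem hm _

/-- The power sums of the centered degrees are polynomials in the largest degree and the genera. -/
theorem sum_pow_centered_mem (hm : 0 < m) {A : Subalgebra ℂ (SyzygySolution d b → ℂ)} {r : ℕ}
    (hQ : (fun w : SyzygySolution d b => w.Q) ∈ A) (hG : ∀ i < r, genusFunction d b i ∈ A) {n : ℕ}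
    (hn : n ≤ m - 1 + r) :
    (fun w : SyzygySolution d b => ∑ i, (syzygySign i : ℂ) * w.centered i ^ n) ∈ A := by
  obtain ⟨U, V, -, -, h⟩ := exists_signedExpSum_eq (d := d) (b := b) hm
  have hQ' : (fun w : SyzygySolution d b => -(w.Q / 2)) ∈ A := by
    have e : (fun w : SyzygySolution d b => -(w.Q / 2)) =
        (-1 / 2 : ℂ) • fun w : SyzygySolution d b => w.Q := by
      funext w
      simp only [Pi.smul_apply, smul_eq_mul]
      ring
    rw [e]
    exact A.smul_mem hQ _
  -- The factor `X` delays the genera by one order: the power sum of order `m - 1 + r` involves only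
  -- the `G i` with `i < r`.
  have hΦ : CoeffsMem A r fun w : SyzygySolution d b => X * (V * w.genusSeries) := by
    refine CoeffsMem.X_mul fun n hn => ?_
    refine CoeffsMem.mul (N := n) (CoeffsMem.const V) (fun k hk => ?_) n le_rfl
    exact (coeff_genusSeries_mem_iff k).2 (hG k (by omega))
  have hE := (((CoeffsMem.const U).mul (CoeffsMem.expSeries hQ')).mul
    ((CoeffsMem.const 1).sub hΦ))
  have e : (fun w : SyzygySolution d b => ∑ i, (syzygySign i : ℂ) * w.centered i ^ n) =
      (n.factorial : ℂ) • fun w : SyzygySolution d b => coeff n (signedExpSum w.centered) := by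
    funext w
    have : (n.factorial : ℂ) ≠ 0 := Nat.cast_ne_zero.2 (Nat.factorial_ne_zero n)
    simp only [coeff_signedExpSum, Pi.smul_apply, smul_eq_mul]
    field_simp
  rw [e]
  refine A.smul_mem ?_ _
  simp only [h, coeff_X_pow_mul']
  split_ifs with hle
  · exact hE _ (by omega)
  · exact zero_mem A

/-- The genera are polynomials in the centered degrees. -/
theorem genusFunction_mem (hm : 0 < m) (hd : ∀ i, 0 < d i)
    {A : Subalgebra ℂ (SyzygySolution d b → ℂ)}
    (hQ : (fun w : SyzygySolution d b => w.Q) ∈ A)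
    (hy : ∀ i, (fun w : SyzygySolution d b => w.centered i) ∈ A) (n : ℕ) :
    genusFunction d b n ∈ A := by
  obtain ⟨q, rfl⟩ : ∃ q, m = q + 1 := ⟨m - 1, by omega⟩
  obtain ⟨U, V, hU, hV, h⟩ := exists_signedExpSum_eq (d := d) (b := b) hm
  rw [Nat.add_sub_cancel] at hU
  simp only [Nat.add_sub_cancel] at h
  have hU0 : constantCoeff U ≠ 0 := by
    rw [hU]
    exact mul_ne_zero (pow_ne_zero _ (neg_ne_zero.2 one_ne_zero))
      (Finset.prod_ne_zero_iff.2 fun i _ => Nat.cast_ne_zero.2 (hd i).ne')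
  have hUinv : U * U⁻¹ = 1 := PowerSeries.mul_inv_cancel _ hU0
  have hVinv : V * V⁻¹ = 1 := PowerSeries.mul_inv_cancel _ (by simp [hV])
  have hQ' : (fun w : SyzygySolution d b => w.Q / 2) ∈ A := by
    have e : (fun w : SyzygySolution d b => w.Q / 2) =
        (1 / 2 : ℂ) • fun w : SyzygySolution d b => w.Q := by
      funext w
      simp only [Pi.smul_apply, smul_eq_mul]
      ring
    rw [e]
    exact A.smul_mem hQ _
  have hE : ∀ n, (fun w : SyzygySolution d b => coeff n (signedExpSum w.centered)) ∈ A := by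
    intro n
    have e : (fun w : SyzygySolution d b => coeff n (signedExpSum w.centered)) =
        ((n.factorial : ℂ)⁻¹) • ∑ i, algebraMap ℂ (SyzygySolution d b → ℂ) (syzygySign i : ℂ) *
          (fun w : SyzygySolution d b => w.centered i) ^ n := by
      funext w
      simp only [coeff_signedExpSum, Pi.smul_apply, Finset.sum_apply, Pi.mul_apply, Pi.pow_apply,
        Pi.algebraMap_apply, Algebra.algebraMap_self, RingHom.id_apply, smul_eq_mul]
      ring
    rw [e]
    exact A.smul_mem (sum_mem fun i _ => mul_mem (A.algebraMap_mem _) (pow_mem (hy i) n)) _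
  have hK : CoeffsMem A (n + 1) fun w : SyzygySolution d b =>
      U * expSeries (-(w.Q / 2)) * (1 - X * (V * w.genusSeries)) := by
    intro k _
    have := hE (k + q)
    simpa only [h, coeff_X_pow_mul] using this
  have hL := ((CoeffsMem.const 1).sub (((CoeffsMem.const U⁻¹).mul
    (CoeffsMem.expSeries hQ')).mul hK))
  have hVΦ : CoeffsMem A n fun w : SyzygySolution d b => V * w.genusSeries := by
    intro k hk
    have h1 := hL (k + 1) (by omega)
    have e : ∀ w : SyzygySolution d b, 1 - U⁻¹ * expSeries (w.Q / 2) *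
        (U * expSeries (-(w.Q / 2)) * (1 - X * (V * w.genusSeries))) =
          X * (V * w.genusSeries) := by
      intro w
      linear_combination -(expSeries (w.Q / 2) * expSeries (-(w.Q / 2)) *
        (1 - X * (V * w.genusSeries))) * hUinv -
          (1 - X * (V * w.genusSeries)) * expSeries_mul_neg (w.Q / 2)
    simpa only [e, coeff_succ_X_mul] using h1
  rw [← coeff_genusSeries_mem_iff]
  have h2 := ((CoeffsMem.const V⁻¹).mul hVΦ) n le_rfl
  have e : ∀ w : SyzygySolution d b, V⁻¹ * (V * w.genusSeries) = w.genusSeries := by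
    intro w
    linear_combination w.genusSeries * hVinv
  simpa only [e] using h2

/-- The genera of index at most `2 * s` are polynomials in `G 0` and the genera of odd index. -/
theorem genusFunction_mem_of_odd (hm : 0 < m) (hd : ∀ i, 0 < d i)
    (hb : ∀ k l, k + l + 1 = m → b k = b l) {A : Subalgebra ℂ (SyzygySolution d b → ℂ)} {s : ℕ}
    (h0 : genusFunction d b 0 ∈ A) (hodd : ∀ i < s, genusFunction d b (2 * i + 1) ∈ A) :
    ∀ n ≤ 2 * s, genusFunction d b n ∈ A := by
  intro n
  induction n using Nat.strong_induction_on with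
  | _ n ih =>
    intro hn
    rcases Nat.even_or_odd' n with ⟨r, rfl | rfl⟩
    · rcases Nat.eq_zero_or_pos r with rfl | hr
      · exact h0
      have hF : (fun w : SyzygySolution d b => 2 * w.G 0 - 1) ∈ A :=
        sub_mem (mul_mem (A.algebraMap_mem 2) h0) (one_mem A)
      have e : genusFunction d b (2 * r) = (fun w => 2 * w.G 0 - 1) *
          (algebraMap ℂ _ (1 / 2) * ∑ p ∈ Finset.range (2 * r - 1),
            (algebraMap ℂ _ (((2 * r).choose p : ℂ) * ((bernoulli (2 * r - p) : ℚ) : ℂ) /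
                ((p : ℂ) + 1)) +
              algebraMap ℂ _ ((-1) ^ p * ((2 * r).choose (p + 1) : ℂ)) *
                genusFunction d b (2 * r - p - 1)) * (fun w => 2 * w.G 0 - 1) ^ p -
            algebraMap ℂ _ ((2 * (r : ℂ) - 1) / (2 * (r : ℂ) + 1) / 4) *
              (fun w => 2 * w.G 0 - 1) ^ (2 * r)) := by
        funext w
        simp only [genusFunction, Pi.mul_apply, Pi.sub_apply, Pi.algebraMap_apply,
          Finset.sum_apply, Pi.add_apply, Pi.pow_apply, Algebra.algebraMap_self, RingHom.id_apply]
        rw [w.G_even hm hd hb r hr]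
        ring
      rw [e]
      refine mul_mem hF (sub_mem (mul_mem (A.algebraMap_mem _) (sum_mem fun p hp => ?_))
        (mul_mem (A.algebraMap_mem _) (pow_mem hF _)))
      refine mul_mem (add_mem (A.algebraMap_mem _) (mul_mem (A.algebraMap_mem _) ?_)) (pow_mem hF _)
      exact ih _ (by omega) (by omega)
    · exact hodd r (by omega)

end GenusAlgebra

end

noncomputable section

/-! ### Reduction to half of the nodes -/

section HalfIndex

variable {m : ℕ} {d : Fin m → ℕ} {b : ℕ → ℕ}

/-- A fundamental domain for the reflection of the syzygies: the rows below the middle, and half of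
the middle row. -/
abbrev IsHalf (i : Σ k : Fin m, Fin (b k)) : Prop :=
  2 * (i.1 : ℕ) + 1 < m ∨ (2 * (i.1 : ℕ) + 1 = m ∧ 2 * (i.2 : ℕ) + 1 < b i.1)

/-- A fixed point of the reflection could only be the centre of a middle row of odd length, which
evenness excludes. -/
theorem isHalf_syzygyReflection_iff (hb : ∀ k l, k + l + 1 = m → b k = b l)
    (heven : ∀ k, 2 * k + 1 = m → Even (b k)) (i : Σ k : Fin m, Fin (b k)) :
    IsHalf (syzygyReflection hb i) ↔ ¬ IsHalf i := by
  have h1 := syzygyReflection_fst hb i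
  have h2 := syzygyReflection_snd hb i
  have h5 := apply_syzygyReflection_fst hb i
  have h6 := i.1.isLt
  have h7 := i.2.isLt
  unfold IsHalf
  by_cases h : 2 * (i.1 : ℕ) + 1 = m
  · obtain ⟨c, hc⟩ := heven _ h
    omega
  · omega

theorem sum_eq_sum_isHalf {M : Type*} [AddCommMonoid M]
    (hb : ∀ k l, k + l + 1 = m → b k = b l) (heven : ∀ k, 2 * k + 1 = m → Even (b k))
    (f : (Σ k : Fin m, Fin (b k)) → M) :
    ∑ i, f i = ∑ j : {i : Σ k : Fin m, Fin (b k) // IsHalf i},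
      (f j + f (syzygyReflection hb j)) := by
  rw [← Fintype.sum_subtype_add_sum_subtype (fun i => IsHalf i) f, Finset.sum_add_distrib]
  congr 1
  refine (Equiv.sum_comp ((syzygyReflection_involutive hb).toPerm.subtypeEquiv
    fun i => ?_) fun i : {i // ¬ IsHalf i} => f i).symm
  rw [Function.Involutive.coe_toPerm, isHalf_syzygyReflection_iff hb heven, not_not]

theorem neg_one_pow_mul_eq_of_even {n : ℕ} (h : Even (m - 1 + n)) (x : ℂ) (e : ℤ) :
    (((-1) ^ (m - 1) * e : ℤ) : ℂ) * (-x) ^ n = e * x ^ n := by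
  have h1 : (-1 : ℂ) ^ (m - 1) * (-1) ^ n = 1 := by rw [← pow_add, h.neg_one_pow]
  rw [neg_pow]
  push_cast
  linear_combination (e : ℂ) * x ^ n * h1

theorem neg_one_pow_mul_eq_of_odd {n : ℕ} (h : Odd (m - 1 + n)) (x : ℂ) (e : ℤ) :
    (((-1) ^ (m - 1) * e : ℤ) : ℂ) * (-x) ^ n = -(e * x ^ n) := by
  have h1 : (-1 : ℂ) ^ (m - 1) * (-1) ^ n = -1 := by rw [← pow_add, h.neg_one_pow]
  rw [neg_pow]
  push_cast
  linear_combination (e : ℂ) * x ^ n * h1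

/-- A node and its reflection contribute equally when `m - 1 + n` is even and cancel when it is odd,
so only exponents of the parity of `m - 1` give conditions. -/
theorem sum_pow_eq_two_mul (hb : ∀ k l, k + l + 1 = m → b k = b l)
    (heven : ∀ k, 2 * k + 1 = m → Even (b k)) {y : (Σ k : Fin m, Fin (b k)) → ℂ}
    (hy : ∀ i, y (syzygyReflection hb i) = -y i) {n : ℕ} (hn : Even (m - 1 + n)) :
    ∑ i, (syzygySign i : ℂ) * y i ^ n =
      2 * ∑ j : {i : Σ k : Fin m, Fin (b k) // IsHalf i}, (syzygySign j.1 : ℂ) * y j ^ n := by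
  rw [sum_eq_sum_isHalf hb heven, Finset.mul_sum]
  refine Finset.sum_congr rfl fun j _ => ?_
  rw [hy, syzygySign_syzygyReflection, neg_one_pow_mul_eq_of_even hn]
  ring

theorem sum_pow_eq_zero_of_odd (hb : ∀ k l, k + l + 1 = m → b k = b l)
    (heven : ∀ k, 2 * k + 1 = m → Even (b k)) {y : (Σ k : Fin m, Fin (b k)) → ℂ}
    (hy : ∀ i, y (syzygyReflection hb i) = -y i) {n : ℕ} (hn : Odd (m - 1 + n)) :
    ∑ i, (syzygySign i : ℂ) * y i ^ n = 0 := by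
  rw [sum_eq_sum_isHalf hb heven]
  refine Finset.sum_eq_zero fun j _ => ?_
  rw [hy, syzygySign_syzygyReflection, neg_one_pow_mul_eq_of_odd hn, add_neg_cancel]

theorem sum_range_two_mul_add_one {q : ℕ} (hb : ∀ k l, k + l + 1 = 2 * q + 1 → b k = b l) :
    ∑ k ∈ range (2 * q + 1), b k = 2 * ∑ k ∈ range q, b k + b q := by
  rw [show 2 * q + 1 = (q + 1) + q by ring, Finset.sum_range_add, Finset.sum_range_succ,
    ← Finset.sum_range_reflect]
  have : ∑ x ∈ range q, b (q + 1 + x) = ∑ j ∈ range q, b (q - 1 - j) := by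
    refine Finset.sum_congr rfl fun x hx => hb _ _ ?_
    have := Finset.mem_range.1 hx
    omega
  rw [this]
  ring

/-- The number of syzygies in the middle row is even. -/
theorem SyzygySolution.even_middle (w : SyzygySolution d b) (hm : 2 ≤ m)
    (hb : ∀ k l, k + l + 1 = m → b k = b l) (k : ℕ) (hk : 2 * k + 1 = m) : Even (b k) := by
  subst hk
  -- The alternating sum of the Betti numbers vanishes; modulo `2` the signs disappear and the rows
  -- off the middle cancel in pairs.
  have h := sum_pow_centered_eq_zero w (n := 0) (by omega)
  simp only [pow_zero, mul_one] at h
  have h1 : ∑ i : (Σ k' : Fin (2 * k + 1), Fin (b k')), syzygySign i = 0 := by exact_mod_cast h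
  have h2 : ((∑ i : (Σ k' : Fin (2 * k + 1), Fin (b k')), syzygySign i : ℤ) : ZMod 2) =
      ((∑ l ∈ range (2 * k + 1), b l : ℕ) : ZMod 2) := by
    rw [← Fin.sum_univ_eq_sum_range b, Fintype.sum_sigma]
    push_cast
    refine Finset.sum_congr rfl fun l _ => ?_
    simp only [syzygySign]
    have h3 : (-1 : ZMod 2) = 1 := by decide
    push_cast
    simp [h3]
  rw [h1, sum_range_two_mul_add_one hb, Int.cast_zero, eq_comm, ZMod.natCast_eq_zero_iff_even] at h2
  rw [Nat.even_add] at h2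
  exact h2.1 (even_two_mul _)

/-- Every symmetric configuration of nodes whose power sums of low order are those of a solution is
the family of centered degrees of a solution. -/
theorem SyzygySolution.exists_of_sum_pow_eq (w₀ : SyzygySolution d b) (hm : 2 ≤ m)
    (hd : ∀ i, 0 < d i) (hb0 : b 0 = 1) (hb : ∀ k l, k + l + 1 = m → b k = b l)
    (y : {i : Σ k : Fin m, Fin (b k) // IsHalf i} → ℂ)
    (hy : ∀ i ≤ m / 2 - 1, ∑ j, (syzygySign j.1 : ℂ) * y j ^ (2 * i + (1 + m % 2)) =
      ∑ j : {i : Σ k : Fin m, Fin (b k) // IsHalf i},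
        (syzygySign j.1 : ℂ) * w₀.centered j ^ (2 * i + (1 + m % 2))) :
    ∃ w : SyzygySolution d b, ∀ j : {i : Σ k : Fin m, Fin (b k) // IsHalf i},
      w.centered j = y j := by
  have heven := w₀.even_middle hm hb
  have hiff := isHalf_syzygyReflection_iff hb heven
  have hinv := syzygyReflection_involutive hb
  let Y : (Σ k : Fin m, Fin (b k)) → ℂ := fun i =>
    if h : IsHalf i then y ⟨i, h⟩ else -y ⟨syzygyReflection hb i, (hiff i).2 h⟩
  have hYhalf : ∀ j : {i : Σ k : Fin m, Fin (b k) // IsHalf i}, Y j = y j := fun j => by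
    simp only [Y, dif_pos j.2]
  have hYrefl : ∀ i, Y (syzygyReflection hb i) = -Y i := by
    intro i
    by_cases h : IsHalf i
    · have h' : ¬ IsHalf (syzygyReflection hb i) := by rwa [hiff, not_not]
      simp only [Y, dif_pos h, dif_neg h']
      congr 2
      exact Subtype.ext (hinv i)
    · simp only [Y, dif_neg h, dif_pos ((hiff i).2 h), neg_neg]
  have hsum : ∀ n, n + 1 ≤ m → ∑ i, (syzygySign i : ℂ) * Y i ^ n =
      ∑ i, (syzygySign i : ℂ) * w₀.centered i ^ n := by
    intro n hn
    rcases Nat.even_or_odd (m - 1 + n) with h | h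
    -- The exponent `0`, absent from the hypothesis, does not depend on the nodes.
    · rcases Nat.eq_zero_or_pos n with rfl | hn0
      · simp
      rw [sum_pow_eq_two_mul hb heven hYrefl h,
        sum_pow_eq_two_mul hb heven (w₀.centered_syzygyReflection hb) h]
      simp only [hYhalf]
      obtain ⟨c, hc⟩ := h
      obtain ⟨i, hi⟩ : ∃ i, n = 2 * i + (1 + m % 2) := ⟨(n - (1 + m % 2)) / 2, by omega⟩
      rw [hi, hy i (by omega)]
    · rw [sum_pow_eq_zero_of_odd hb heven hYrefl h,
        sum_pow_eq_zero_of_odd hb heven (w₀.centered_syzygyReflection hb) h]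
  have h0 : ∀ n, n + 1 < m → coeff n (signedExpSum Y) = 0 := by
    intro n hn
    rw [coeff_signedExpSum, hsum n hn.le, sum_pow_centered_eq_zero w₀ hn, zero_div]
  have h1 : coeff (m - 1) (signedExpSum Y) = (-1) ^ (m - 1) * ∏ i, (d i : ℂ) := by
    rw [coeff_signedExpSum, hsum _ (by omega), sum_pow_centered_eq w₀ (by omega),
      mul_div_cancel_left₀ _ (Nat.cast_ne_zero.2 (Nat.factorial_ne_zero _))]
  let i₀ : Σ k : Fin m, Fin (b k) := ⟨⟨0, by omega⟩, ⟨0, by simp [hb0]⟩⟩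
  -- Forced by the condition that the degree in row zero vanishes.
  let Q : ℂ := -2 * Y i₀
  obtain ⟨Φ, hΦ⟩ := exists_genusSeries_of_coeff (by omega) hd Q h0 h1
  refine ⟨{ C := fun k j => Y ⟨k, j⟩ + Q / 2
            Q := Q
            G := fun r => coeff r Φ * r.factorial
            zero_row := ?_
            symm := ?_
            hilbert := ?_ }, fun j => ?_⟩
  · intro k j hk
    have hj := j.isLt
    have e : (⟨k, j⟩ : Σ k : Fin m, Fin (b k)) = i₀ := by
      refine syzygyIndex_ext hk ?_
      have : b k = 1 := by rw [hk, hb0]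
      change (j : ℕ) = 0
      omega
    rw [e]
    simp only [Q]
    ring
  · intro k l j j' hkl hj
    have hj' := j'.isLt
    have hbl := hb k l hkl
    have e : (⟨l, j'⟩ : Σ k : Fin m, Fin (b k)) = syzygyReflection hb ⟨k, j⟩ := by
      refine syzygyIndex_ext ?_ ?_
      · rw [syzygyReflection_fst]
        change (l : ℕ) = m - ((k : ℕ) + 1)
        omega
      · rw [syzygyReflection_snd]
        change (j' : ℕ) = b k - ((j : ℕ) + 1)
        omega
    rw [e, hYrefl]
    ring
  · have e : (PowerSeries.mk fun r => coeff r Φ * (r.factorial : ℂ) / (r.factorial : ℂ)) = Φ := by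
      ext r
      rw [coeff_mk, mul_div_cancel_right₀ _ (Nat.cast_ne_zero.2 (Nat.factorial_ne_zero _))]
    rw [e, sum_sum_expSeries_eq Q Y]
    exact hΦ
  · rw [← hYhalf j]
    simp only [SyzygySolution.centered]
    ring

theorem card_filter_two_mul_add_one_lt (n : ℕ) :
    (Finset.univ.filter fun j : Fin n => 2 * (j : ℕ) + 1 < n).card = n / 2 := by
  rw [← Fintype.card_fin (n / 2), ← Finset.card_univ]
  symm
  refine Finset.card_bij (fun j _ => ⟨j, by omega⟩) ?_ ?_ ?_
  · intro j _
    simp only [Finset.mem_filter, Finset.mem_univ, true_and]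
    omega
  · intro i _ j _ h
    simpa [Fin.ext_iff] using h
  · intro j hj
    have := (Finset.mem_filter.1 hj).2
    exact ⟨⟨j, by omega⟩, Finset.mem_univ _, rfl⟩

theorem card_isHalf :
    Fintype.card {i : Σ k : Fin m, Fin (b k) // IsHalf i} =
      if Even m then ∑ k ∈ range (m / 2), b k
      else (∑ k ∈ range (m / 2), b k) + b (m / 2) / 2 := by
  have h1 : (Finset.univ.filter fun i : Σ k : Fin m, Fin (b k) => IsHalf i) =
      Finset.univ.sigma fun k : Fin m => Finset.univ.filter fun j : Fin (b k) => IsHalf ⟨k, j⟩ := by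
    ext ⟨k, j⟩
    simp
  have h2 : ∀ k : Fin m, (Finset.univ.filter fun j : Fin (b k) =>
      IsHalf (⟨k, j⟩ : Σ k : Fin m, Fin (b k))).card =
      (fun k : ℕ => if 2 * k + 1 < m then b k else if 2 * k + 1 = m then b k / 2 else 0) k := by
    intro k
    dsimp only [IsHalf]
    split_ifs with h h'
    · simp [h]
    · simp only [h', lt_irrefl, true_and, false_or]
      exact card_filter_two_mul_add_one_lt (b k)
    · simp [h, h']
  rw [Fintype.card_subtype, h1, Finset.card_sigma, Finset.sum_congr rfl fun k _ => h2 k,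
    Fin.sum_univ_eq_sum_range
      (fun k : ℕ => if 2 * k + 1 < m then b k else if 2 * k + 1 = m then b k / 2 else 0)]
  split_ifs with hm
  · symm
    refine Finset.sum_subset_zero_on_sdiff ?_ ?_ ?_
    · exact Finset.range_subset_range.2 (Nat.div_le_self m 2)
    · intro k hk
      obtain ⟨c, hc⟩ := hm
      simp only [Finset.mem_sdiff, Finset.mem_range] at hk
      rw [if_neg (by omega), if_neg (by omega)]
    · intro k hk
      have := Finset.mem_range.1 hk
      rw [if_pos (by omega)]
  · rw [Nat.not_even_iff] at hm
    clear h1 h2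
    obtain ⟨q, rfl⟩ : ∃ q, m = 2 * q + 1 := ⟨m / 2, by omega⟩
    have hq : (2 * q + 1) / 2 = q := by omega
    rw [hq, show 2 * q + 1 = (q + 1) + q by ring, Finset.sum_range_add, Finset.sum_range_succ,
      if_neg (by omega), if_pos (by omega)]
    rw [Finset.sum_eq_zero (s := range q) (f := fun x => if 2 * (q + 1 + x) + 1 < q + 1 + q then _
      else _), add_zero]
    · congr 1
      refine Finset.sum_congr rfl fun k hk => ?_
      have := Finset.mem_range.1 hk
      rw [if_pos (by omega)]
    · intro k _
      rw [if_neg (by omega), if_neg (by omega)]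

end HalfIndex

end

noncomputable section

/-! ### Dimension count and independence of the genera on the variety -/

section SolutionVariety

variable {m : ℕ} {d : Fin m → ℕ} {b : ℕ → ℕ}

theorem Q_mem_of_genusFunction_zero_mem (hm : 0 < m) (hd : ∀ i, 0 < d i)
    (hb : ∀ k l, k + l + 1 = m → b k = b l) {A : Subalgebra ℂ (SyzygySolution d b → ℂ)}
    (h : genusFunction d b 0 ∈ A) : (fun w : SyzygySolution d b => w.Q) ∈ A := by
  have e : (fun w : SyzygySolution d b => w.Q) = algebraMap ℂ _ 2 * genusFunction d b 0 +
      algebraMap ℂ _ (∑ i, (d i : ℂ) - 1) := by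
    funext w
    simp only [genusFunction, Pi.mul_apply, Pi.add_apply, Pi.algebraMap_apply,
      Algebra.algebraMap_self, RingHom.id_apply]
    linear_combination -(w.two_mul_G_zero hm hd hb)
  rw [e]
  exact add_mem (mul_mem (A.algebraMap_mem _) h) (A.algebraMap_mem _)

/-- The structure of the algebra generated by the genera on the solution variety. -/
theorem genera_algebraicIndependent (w₀ : SyzygySolution d b) (hm : 2 ≤ m) (hd : ∀ i, 0 < d i)
    (hb0 : b 0 = 1) (hb : ∀ k l, k + l + 1 = m → b k = b l) :
    ∃ g : ℕ, g + m / 2 = Fintype.card {i : Σ k : Fin m, Fin (b k) // IsHalf i} ∧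
      AlgebraicIndependent ℂ (fun i : Fin g => genusFunction d b (genusIndex i)) ∧
      (∀ n : ℕ, IsAlgebraic
        (Algebra.adjoin ℂ (Set.range fun i : Fin g => genusFunction d b (genusIndex i)))
        (genusFunction d b n)) ∧
      ∀ s : Finset ℕ, AlgebraicIndependent ℂ (fun r : s => genusFunction d b r) → s.card ≤ g := by
  classical
  have hm0 : 0 < m := by omega
  have heven := w₀.even_middle hm hb
  have hq : m / 2 - 1 + 1 = m / 2 := by omega
  let J := {i : Σ k : Fin m, Fin (b k) // IsHalf i}
  let ε : J → ℤ := fun j => syzygySign j.1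
  let y : J → SyzygySolution d b → ℂ := fun j w => w.centered j
  have hε : ∀ j, ε j ≠ 0 := fun j => pow_ne_zero _ (neg_ne_zero.2 one_ne_zero)
  -- The relevant exponents `2 * i + (1 + m % 2)` are `1, 3, …, m - 1` for even `m` and `2, 4, …, m
  -- - 1` for odd `m`: in both cases `m / 2` equations.
  have ha : 1 + m % 2 ≠ 0 := by omega
  have hpar : ∀ i, Even (m - 1 + (2 * i + (1 + m % 2))) := fun i =>
    ⟨m / 2 + m % 2 + i, by omega⟩
  have hhalf : ∀ (w : SyzygySolution d b) i, ∑ j, (ε j : ℂ) * y j w ^ (2 * i + (1 + m % 2)) =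
      (∑ j, (syzygySign j : ℂ) * w.centered j ^ (2 * i + (1 + m % 2))) / 2 := fun w i => by
    rw [sum_pow_eq_two_mul hb heven (w.centered_syzygyReflection hb) (hpar i)]
    ring
  let c : ℂ := ((m - 1).factorial * ((-1) ^ (m - 1) * ∏ i, (d i : ℂ))) / 2
  have hc : c ≠ 0 := by
    refine div_ne_zero (mul_ne_zero (Nat.cast_ne_zero.2 (Nat.factorial_ne_zero _))
      (mul_ne_zero (pow_ne_zero _ (neg_ne_zero.2 one_ne_zero)) ?_)) two_ne_zero
    exact Finset.prod_ne_zero_iff.2 fun i _ => Nat.cast_ne_zero.2 (hd i).ne'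
  have h0 : ∀ (w : SyzygySolution d b), ∀ i < m / 2 - 1,
      ∑ j, (ε j : ℂ) * y j w ^ (2 * i + (1 + m % 2)) = 0 := fun w i hi => by
    rw [hhalf, sum_pow_centered_eq_zero w (by omega), zero_div]
  have h1 : ∀ (w : SyzygySolution d b),
      ∑ j, (ε j : ℂ) * y j w ^ (2 * (m / 2 - 1) + (1 + m % 2)) = c := fun w => by
    rw [hhalf, sum_pow_centered_eq w (by omega),
      show 2 * (m / 2 - 1) + (1 + m % 2) = m - 1 by omega]
  have h0' : ∀ i < m / 2 - 1,
      ∑ j, (ε j : SyzygySolution d b → ℂ) * y j ^ (2 * i + (1 + m % 2)) = 0 := fun i hi => by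
    funext w
    simpa using h0 w i hi
  have h1' : ∑ j, (ε j : SyzygySolution d b → ℂ) * y j ^ (2 * (m / 2 - 1) + (1 + m % 2)) =
      algebraMap ℂ (SyzygySolution d b → ℂ) c := by
    funext w
    simpa using h1 w
  -- The given point `w₀` satisfies the equations, so it has `m / 2` nodes with distinct nonzero
  -- squares, which makes it a regular point for the deformation.
  obtain ⟨T, hT, hTinj, hTne⟩ := exists_card_eq_of_sum_pow (c := fun j => (ε j : ℂ))
    (y := fun j => y j w₀) ha (h0 w₀) (by rw [h1]; exact hc)
  have hcardT : m / 2 ≤ Fintype.card J := by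
    rw [← hq, ← hT]
    exact T.card_le_univ
  have hind : AlgebraicIndependent ℂ fun j : {j // j ∉ T} => y j := by
    obtain ⟨U, hU, hv⟩ := exists_infinite_forall_exists_sum_pow_eq hε ha (fun j => y j w₀) hT hTinj
      fun j hj => (hTne j hj).2
    refine algebraicIndependent_of_forall_exists_eq (U := fun j : {j // j ∉ T} => U j)
      (fun j => hU j) fun v hvU => ?_
    obtain ⟨x, hx, hsum⟩ := hv (fun j => if h : j ∉ T then v ⟨j, h⟩ else (hU j).nonempty.some)
      fun j => by
        by_cases h : j ∉ T
        · simpa [h] using hvU ⟨j, h⟩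
        · simpa only [h, dite_false] using (hU j).nonempty.some_mem
    obtain ⟨w, hw⟩ := w₀.exists_of_sum_pow_eq hm hd hb0 hb x hsum
    refine ⟨w, fun j => ?_⟩
    change w.centered j.1 = v j
    rw [hw, hx _ j.2, dif_pos j.2]
  -- The single syzygy of row zero has degree `0`, so its centred node is `-Q/2`, which `G 0`
  -- determines.
  let j₀ : J := ⟨⟨⟨0, hm0⟩, ⟨0, by simp [hb0]⟩⟩, Or.inl (show 2 * 0 + 1 < m by omega)⟩
  have hj₀ : y j₀ = algebraMap ℂ _ (-1 / 2) * fun w : SyzygySolution d b => w.Q := by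
    funext w
    have : w.centered j₀ = 0 - w.Q / 2 := by
      rw [SyzygySolution.centered, w.zero_row _ _ rfl]
    simp only [y, this, Pi.mul_apply, Pi.algebraMap_apply, Algebra.algebraMap_self,
      RingHom.id_apply]
    ring
  have hQy : (fun w : SyzygySolution d b => w.Q) ∈ Algebra.adjoin ℂ (Set.range y) := by
    have e : (fun w : SyzygySolution d b => w.Q) = algebraMap ℂ _ (-2) * y j₀ := by
      rw [hj₀, ← mul_assoc, ← map_mul]
      norm_num
    rw [e]
    exact mul_mem (Subalgebra.algebraMap_mem _ _) (Algebra.subset_adjoin ⟨j₀, rfl⟩)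
  have hcy : ∀ i, (fun w : SyzygySolution d b => w.centered i) ∈
      Algebra.adjoin ℂ (Set.range y) := by
    intro i
    by_cases h : IsHalf i
    · exact Algebra.subset_adjoin ⟨⟨i, h⟩, rfl⟩
    · have e : (fun w : SyzygySolution d b => w.centered i) =
          -y ⟨syzygyReflection hb i, (isHalf_syzygyReflection_iff hb heven i).2 h⟩ := by
        funext w
        simp only [y, Pi.neg_apply, w.centered_syzygyReflection hb, neg_neg]
      rw [e]
      exact neg_mem (Algebra.subset_adjoin ⟨_, rfl⟩)
  have hGy := genusFunction_mem hm0 hd hQy hcy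
  let g := Fintype.card J - m / 2
  have hg : g + m / 2 = Fintype.card J := Nat.sub_add_cancel hcardT
  have hbound : ∀ {ι : Type} [Fintype ι] {f : ι → SyzygySolution d b → ℂ},
      AlgebraicIndependent ℂ f → (∀ i, f i ∈ Algebra.adjoin ℂ (Set.range y)) →
      Fintype.card ι ≤ g := fun {ι} _ {f} hf hfy => by
    have := card_add_le_of_algebraicIndependent ha hc h0' h1' hf hfy
    omega
  have hgen : AlgebraicIndependent ℂ (fun i : Fin g => genusFunction d b (genusIndex i)) := by
    rcases Nat.eq_zero_or_pos g with hg0 | hgpos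
    · have : IsEmpty (Fin g) := by rw [hg0]; infer_instance
      have : Nonempty (SyzygySolution d b) := ⟨w₀⟩
      rw [algebraicIndependent_empty_type_iff]
      exact (algebraMap ℂ (SyzygySolution d b → ℂ)).injective
    · let A := Algebra.adjoin ℂ (Set.range fun i : Fin g => genusFunction d b (genusIndex i))
      have hA0 : genusFunction d b 0 ∈ A := Algebra.subset_adjoin ⟨⟨0, hgpos⟩, rfl⟩
      have hAodd : ∀ i < g - 1, genusFunction d b (2 * i + 1) ∈ A := fun i hi =>
        Algebra.subset_adjoin ⟨⟨i + 1, by omega⟩, by simp [genusIndex, mul_add]⟩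
      have hA := genusFunction_mem_of_odd hm0 hd hb hA0 hAodd
      have hAQ := Q_mem_of_genusFunction_zero_mem hm0 hd hb hA0
      refine algebraicIndependent_of_sum_pow_mem_adjoin ha hc hε h0' h1' hT hind j₀
        (by rw [Fintype.card_fin]; omega) ?_ fun i hi => ?_
      · rw [hj₀]
        exact mul_mem (A.algebraMap_mem _) hAQ
      · have e : ∑ j, (ε j : SyzygySolution d b → ℂ) * y j ^ (2 * i + (1 + m % 2)) =
            algebraMap ℂ _ (1 / 2) * fun w : SyzygySolution d b =>
              ∑ j, (syzygySign j : ℂ) * w.centered j ^ (2 * i + (1 + m % 2)) := by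
          funext w
          have := hhalf w i
          simp only [Finset.sum_apply, Pi.mul_apply, Pi.intCast_apply, Pi.pow_apply, this,
            Pi.algebraMap_apply, Algebra.algebraMap_self, RingHom.id_apply]
          ring
        rw [e]
        refine mul_mem (A.algebraMap_mem _)
          -- The genera up to index `2 g - 2` are known. The largest exponent needed, for `i = |J| -
          -- 2` with `|J| = g + m / 2`, is `m + 2 g - 3`, within the admissible `m - 1 + r`.
          (sum_pow_centered_mem hm0 (r := 2 * (g - 1) + 1) hAQ (fun k hk => hA k (by omega)) ?_)
        omega
  refine ⟨g, hg, hgen, fun n => ?_, fun s hs => ?_⟩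
  · by_contra hn
    -- A genus transcendental over the `g` chosen ones would give `g + 1` independent functions in
    -- the algebra of the nodes.
    have hopt := AlgebraicIndependent.option_iff.2 ⟨hgen, hn⟩
    have := hbound hopt fun o => by
      cases o with
      | none => exact hGy n
      | some i => exact hGy _
    rw [Fintype.card_option, Fintype.card_fin] at this
    omega
  · have := hbound hs fun r => hGy r
    rwa [Fintype.card_coe] at this

end SolutionVariety

/-! ### Elementary consequences for the generators -/

section Generators

variable {m : ℕ} {d : Fin m → ℕ}

theorem IsMinimalGeneratingTuple.pos (hd : IsMinimalGeneratingTuple d) (i : Fin m) : 0 < d i := by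
  rcases Nat.eq_zero_or_pos (d i) with h | h
  · exact absurd (h ▸ zero_mem _) (hd.minimal i)
  · exact h

/-- A semigroup that is not a complete intersection has at least two generators. -/
theorem two_le_of_not_isCompleteIntersection {𝕂 : Type*} [Field 𝕂]
    (hd : IsMinimalGeneratingTuple d) (hCI : ¬ IsCompleteIntersectionSemigroup 𝕂 d) : 2 ≤ m := by
  by_contra hlt
  have hm : m = 0 ∨ m = 1 := by omega
  rcases hm with rfl | rfl
  · have := hd.gcd_eq_one
    simp at this
  · refine hCI ⟨∅, by simp, ?_⟩
    -- The gcd of a single generator is that generator, so it equals `1` and the presentation of the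
    -- semigroup ring is injective: its zero ideal needs no generators.
    have h1 : d 0 = 1 := by simpa using hd.gcd_eq_one
    rw [Finset.coe_empty, Ideal.span_empty, definingIdeal, eq_comm,
      ← RingHom.injective_iff_ker_eq_bot]
    have h2 : AlgebraicIndependent 𝕂 fun i : Fin 1 => (Polynomial.X : Polynomial 𝕂) ^ d i := by
      rw [algebraicIndependent_unique_type_iff]
      have : d default = 1 := h1
      rw [this, pow_one]
      exact Polynomial.transcendental_X 𝕂
    exact h2

end Generators

end

theorem theorem3 (𝕂 : Type*) [Field 𝕂] {m : ℕ} (d : Fin m → ℕ)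
    (hd : IsMinimalGeneratingTuple d) (hsymm : IsSymmetricSemigroup d)
    (hCI : ¬ IsCompleteIntersectionSemigroup 𝕂 d) :
    -- the number of independent genera, for `m = 2 q` and for `m = 2 q + 1`
    ∃ g : ℕ,
      (∀ q : ℕ, m = 2 * q ∨ m = 2 * q + 1 → (g : ℤ) = variableCount 𝕂 d - q) ∧
      -- the semigroup itself, its degrees of syzygies and its genera, is a point of the variety
      (∃ w : SyzygySolution d (betti 𝕂 d),
        (∀ (k : Fin m) (s : ℕ), Nat.card {j // w.C k j = s} = gradedBetti 𝕂 d k s) ∧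
        ∀ r : ℕ, w.G r = genus d r) ∧
      -- `G 0, G 1, G 3, …, G (2 g - 3)` are algebraically independent functions on the variety
      AlgebraicIndependent ℂ
        (fun i : Fin g => genusFunction d (betti 𝕂 d) (genusIndex i)) ∧
      -- every genus is algebraic over them
      (∀ n : ℕ, IsAlgebraic
        (Algebra.adjoin ℂ
          (Set.range fun i : Fin g => genusFunction d (betti 𝕂 d) (genusIndex i)))
        (genusFunction d (betti 𝕂 d) n)) ∧
      -- no choice of more than `g` genera is algebraically independent
      (∀ s : Finset ℕ,
        AlgebraicIndependent ℂ (fun r : s => genusFunction d (betti 𝕂 d) r) → s.card ≤ g) ∧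
      -- the symmetry relations for the genera of even index, with `F = 2 * G 0 - 1`
      (∀ (w : SyzygySolution d (betti 𝕂 d)) (r : ℕ), 1 ≤ r →
        w.G (2 * r) = (2 * w.G 0 - 1) *
          (1 / 2 * ∑ p ∈ Finset.range (2 * r - 1),
              (((2 * r).choose p : ℂ) * ((bernoulli (2 * r - p) : ℚ) : ℂ) / ((p : ℂ) + 1) +
                (-1) ^ p * ((2 * r).choose (p + 1) : ℂ) * w.G (2 * r - p - 1)) *
                (2 * w.G 0 - 1) ^ p -
            (2 * (r : ℂ) - 1) / (2 * (r : ℂ) + 1) * ((2 * w.G 0 - 1) ^ (2 * r) / 4)))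
 := by
  have hpos := hd.pos
  have hm := two_le_of_not_isCompleteIntersection hd hCI
  have hb : ∀ k l, k + l + 1 = m → betti 𝕂 d k = betti 𝕂 d l := by
    intro k l hkl
    subst hkl
    exact betti_eq_of_add_eq hpos hsymm rfl
  obtain ⟨w₀, hw₀, hG₀⟩ := exists_syzygySolution (𝕂 := 𝕂) (by omega) hpos hsymm
  obtain ⟨g, hg, hind, halg, hmax⟩ :=
    genera_algebraicIndependent w₀ hm hpos (betti_zero hpos) hb
  refine ⟨g, fun q hq => ?_, ⟨w₀, hw₀, hG₀⟩, hind, halg, hmax, fun w r hr =>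
    w.G_even (by omega) hpos hb r hr⟩
  rw [card_isHalf] at hg
  change g + m / 2 = variableCount 𝕂 d at hg
  omega
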